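/- **Model.** A network is a finite connected simple graph $G=(V,E)$ of diameter $\mathcal D$ (at least one vertex), one vertex of which is the *leader*. The vertices have distinct IDs of at most $k\,\ell(V)$ bits, where $k$ is a constant and $\ell(V)=\lfloor\log_2|V|\rfloor+1$. Every vertex is a computer with unbounded memory and computational power; all run the same code, and each has independent fair coins. Initially a vertex knows only its ID, the IDs of its neighbours, and whether it is the leader. Computation proceeds in synchronous rounds; in each round every vertex that has not halted reads the messages sent to it in the previous round, computes, and sends at most one message (a bit string) to each of its neighbours. A vertex that has halted with an output does nothing any more. An algorithm *runs in time $t$ with $M$ messages of at most $B$ bits* if, for all outcomes of the coins, every vertex halts after at most $t$ rounds, at most $M$ messages are sent in total, and no message is longer than $B$ bits. A *cut edge* is an edge whose deletion disconnects $G$. A *$b$-bit circulation* is a map $\phi:E\to\{0,1\}^b$ such that, for each $i$, every vertex is incident to an even number of edges $e$ with $\phi_i(e)=1$. A *BFS tree* is a spanning tree of $G$ preserving all distances from its root. An algorithm *builds a BFS tree* if, for all outcomes of the coins, in the end each vertex knows its parent and which of its incident edges belong to the tree, for some BFS tree rooted at the leader. It *samples a random $b$-bit circulation* if in the end each vertex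 knows $\phi(e)$ for each of its incident edges $e$, where $\phi$ is uniformly distributed over all $b$-bit circulations of $G$. **Theorem.** 1. There are distributed algorithms $A_b$ $(b\in\mathbb N)$ and absolute constants $C_1,C_2$, and for all constants $c,k$ there is a constant $C_3$, such that for every network with IDs of at most $k\,\ell(V)$ bits and every $b\le c\,\ell(V)$, $A_b$ builds a BFS tree and samples a random $b$-bit circulation in time $C_1\mathcal D$, with at most $C_2|E|$ messages of at most $C_3\,\ell(V)$ bits. 2. There are a single distributed algorithm $A$ (which is not told $|V|$, $|E|$ or $\mathcal D$) and absolute constants $C_1,C_2$, and for every constant $k$ there is a constant $C_3$, such that on every network with IDs of at most $k\,\ell(V)$ bits, $A$ runs in time $C_1\mathcal D$ with at most $C_2|E|$ messages of at most $C_3\,\ell(V)$ bits; it builds a BFS tree and samples a random $\lceil\log_2(|V||E|)\rceil$-bit circulation (a $0$-bit one if $|V|=1$); and with probability at least $1-1/|V|$, in the end every vertex knows exactly which of its incident edges are cut edges. -/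

import Mathlib

open MeasureTheory

noncomputable section

namespace Congest

/-! ### The synchronous network -/

/-- A network: a connected graph whose vertices are the computers, an assignment of distinct
identifiers to the vertices, and a distinguished leader. -/
structure Network (V : Type) where
  graph : SimpleGraph V
  connected : graph.Connected
  ID : V → ℕ
  ID_injective : Function.Injective ID
  leader : V

/-- What a vertex knows initially: its identifier, those of its neighbours, and whether it is the
leader. -/
structure LocalView where
  id : ℕ
  nbrs : Finset ℕ
  isLeader : Bool

open Classical in
/-- The initial knowledge of the vertex `v`. -/
def Network.view {V : Type} [Fintype V] (N : Network V) (v : V) : LocalView where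
  id := N.ID v
  nbrs := (Finset.univ.filter fun u => N.graph.Adj v u).image N.ID
  isLeader := decide (v = N.leader)

/-- The number `|E|` of edges. -/
def Network.numEdges {V : Type} (N : Network V) : ℕ := N.graph.edgeSet.ncard

/-- A message is a bit string. -/
abbrev Msg := List Bool

/-- A collection of at most one message for each identifier: the messages which a vertex receives
from, or sends to, its neighbours in one round. -/
abbrev Mailbox := ℕ → Option Msg

/-- A randomized synchronous distributed algorithm, all of whose vertices run the same code, and
which computes a value of type `O` at every vertex. As soon as `output s` is not `none`, a vertex
with state `s` has halted with that output. Otherwise, in each round, it reads the messages it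
has received, flips `coins` fresh fair coins, changes its state and sends messages. Neither memory
nor local computation is bounded. -/
structure Algorithm (O : Type) where
  State : Type
  init : LocalView → State
  output : State → Option O
  coins : State → Mailbox → ℕ
  step : State → Mailbox → List Bool → State × Mailbox

/-! ### Executions -/

/-- The outcomes of all coin flips: `ω (v, t, i)` is the `i`-th coin of the vertex `v` in the
round which follows `t` completed rounds. -/
abbrev Coins (V : Type) := V × ℕ × ℕ → Bool

/-- All coins are fair and independent. -/
def coinMeasure (V : Type) : Measure (Coins V) :=
  Measure.infinitePi fun _ => (PMF.uniformOfFintype Bool).toMeasure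

namespace Algorithm

variable {O : Type} (A : Algorithm O) {V : Type} (N : Network V)

open Classical in
/-- The messages that arrive at `v`, indexed by the identifiers of the senders, if every vertex `u`
has sent the messages `out u`. Only neighbours can communicate. -/
def deliver (out : V → Mailbox) (v : V) : Mailbox :=
  Function.extend N.ID (fun u => if N.graph.Adj u v then out u (N.ID v) else none) fun _ => none

/-- The state of each vertex after `t` rounds, with the messages that it has sent in the `t`-th
round. A halted vertex keeps its state and sends nothing. -/
def config [Fintype V] (ω : Coins V) : ℕ → V → A.State × Mailbox
  | 0 => fun v => (A.init (N.view v), fun _ => none)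
  | t + 1 => fun v =>
    let s := (config ω t v).1
    let inbox := deliver N (fun u => (config ω t u).2) v
    if (A.output s).isSome then (s, fun _ => none)
    else A.step s inbox (List.ofFn fun i : Fin (A.coins s inbox) => ω (v, t, i.val))

open Classical in
/-- The message, if any, that `u` sends to `v` in the `t`-th round. -/
def sent [Fintype V] (ω : Coins V) (t : ℕ) (u v : V) : Option Msg :=
  if N.graph.Adj u v then (A.config N ω t u).2 (N.ID v) else none

/-- The total number of messages sent in the first `t` rounds. -/
def messages [Fintype V] (ω : Coins V) (t : ℕ) : ℕ :=
  ∑ i ∈ Finset.range (t + 1), ∑ u, ∑ v, if (A.sent N ω i u v).isSome then 1 else 0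

/-- The execution comes to an end, and every vertex `v` has halted with the output `out v`. -/
def HaltsWith [Fintype V] (ω : Coins V) (out : V → O) : Prop :=
  ∃ t, ∀ v, A.output (A.config N ω t v).1 = some (out v)

/-- Whatever the coins show, every vertex halts after at most `time` rounds, at most `msgs`
messages are sent in total, and every message has at most `bits` bits. -/
structure RunsWithin [Fintype V] (time msgs bits : ℕ) : Prop where
  time_le : ∀ ω v, (A.output (A.config N ω time v).1).isSome
  messages_le : ∀ ω t, A.messages N ω t ≤ msgs
  bits_le : ∀ ω t u v m, A.sent N ω t u v = some m → m.length ≤ bits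

end Algorithm

/-! ### Cut edges, circulations, breadth-first search trees -/

section Graph

variable {V : Type} (G : SimpleGraph V)

/-- A cut edge is an edge whose deletion disconnects the graph. -/
def IsCutEdge (e : Sym2 V) : Prop := e ∈ G.edgeSet ∧ ¬ (G.deleteEdges {e}).Connected

/-- A binary circulation is a set `F` of edges such that every vertex has even degree in
`(V, F)`. -/
def IsBinaryCirculation (F : Set (Sym2 V)) : Prop :=
  F ⊆ G.edgeSet ∧ ∀ v, Even {e ∈ F | v ∈ e}.ncard

/-- A `b`-bit circulation assigns a string of `b` bits to each edge, so that for each `i` the edges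
whose `i`-th bit is one form a binary circulation. -/
def IsBitCirculation (b : ℕ) (φ : G.edgeSet → Fin b → Bool) : Prop :=
  ∀ i, IsBinaryCirculation G (Subtype.val '' {e | φ e i = true})

/-- `T` is a breadth-first search tree of `G` with root `r`: a spanning tree which preserves the
distances from `r`. -/
def IsBFSTree (r : V) (T : SimpleGraph V) : Prop :=
  T ≤ G ∧ T.IsTree ∧ ∀ v, T.dist r v = G.dist r v

end Graph

/-! ### Outputs and their meaning

Data about an edge is stored at both of its endpoints, each of which refers to the edge by the
identifier of the other one. -/

/-- The local output for a rooted tree and an edge labelling: the identifier of the parent, and for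
each neighbour whether the edge to it is in the tree, and the label of that edge. -/
structure TreeAndLabels where
  parent : Option ℕ
  inTree : ℕ → Bool
  label : ℕ → List Bool

/-- The local output of a cut edge algorithm: as before, and for each neighbour whether the edge to
it is believed to be a cut edge. -/
structure CutEdgeOutput extends TreeAndLabels where
  isCut : ℕ → Bool

section Meaning

variable {V : Type} (N : Network V)

/-- The outputs describe a breadth-first search tree rooted at the leader. -/
def DescribesBFSTree (out : V → TreeAndLabels) : Prop :=
  ∃ T : SimpleGraph V, IsBFSTree N.graph N.leader T ∧
    (∀ u v, N.graph.Adj u v → ((out u).inTree (N.ID v) = true ↔ T.Adj u v)) ∧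
    ∀ v p, (out v).parent = some p ↔
      ∃ u, N.ID u = p ∧ T.Adj u v ∧ T.dist N.leader u + 1 = T.dist N.leader v

/-- Each vertex has stored the string `φ e` for each of its incident edges `e`. -/
def DescribesLabelling {b : ℕ} (out : V → TreeAndLabels)
    (φ : N.graph.edgeSet → Fin b → Bool) : Prop :=
  ∀ (u v : V) (h : N.graph.Adj u v),
    (out u).label (N.ID v) = List.ofFn (φ ⟨s(u, v), N.graph.mem_edgeSet.mpr h⟩)

/-- Each vertex knows which of its incident edges are cut edges. -/
def DescribesCutEdges (out : V → CutEdgeOutput) : Prop :=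
  ∀ u v, N.graph.Adj u v → ((out u).isCut (N.ID v) = true ↔ IsCutEdge N.graph s(u, v))

/-- Whatever the coins show, the algorithm `A` builds a breadth-first search tree rooted at the
leader; `tl` extracts the tree from the output. -/
def BuildsBFSTree {O : Type} (A : Algorithm O) (tl : O → TreeAndLabels) [Fintype V] : Prop :=
  ∀ ω, ∃ out, A.HaltsWith N ω out ∧ DescribesBFSTree N (fun v => tl (out v))

/-- The labels computed by `A` are a uniformly random `b`-bit circulation: each of the `b`-bit
circulations has the same probability, one over their number. -/
def SamplesCirculation {O : Type} (A : Algorithm O) (tl : O → TreeAndLabels) [Fintype V]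
    (b : ℕ) : Prop :=
  ∀ φ : N.graph.edgeSet → Fin b → Bool, IsBitCirculation N.graph b φ →
    (coinMeasure V).real
        {ω | ∃ out, A.HaltsWith N ω out ∧ DescribesLabelling N (fun v => tl (out v)) φ} =
      1 / (Nat.card {ψ : N.graph.edgeSet → Fin b → Bool // IsBitCirculation N.graph b ψ} : ℝ)

/-- The probability that `A` halts with every vertex knowing exactly which of its incident edges are
cut edges. -/
def cutEdgeSuccess (A : Algorithm CutEdgeOutput) [Fintype V] : ℝ :=
  (coinMeasure V).real {ω | ∃ out, A.HaltsWith N ω out ∧ DescribesCutEdges N out}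

end Meaning

end Congest

end

/-! The algorithm makes two passes, each a flood from the leader followed by an echo towards it. In
the first flood a vertex at depth `d` sends `d` rounds after the leader. The neighbours it has heard
from by then are exactly those closer to the leader, and the one with the smallest ID becomes its
parent; this gives a BFS tree. The flood message tells each neighbour whether it was chosen, so a
vertex that has heard from all neighbours knows its children. The first echo sums vertex counts and
degrees up the tree, from which the leader computes the number `b` of bits.

In the second flood every vertex proposes random `b`-bit labels for its edges, and their length
reveals `b` to the receivers. A non-tree edge takes the proposal of its end with the smaller ID. In
the second echo each vertex labels its parent edge with the sum of its other labels, so that its own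
sum vanishes. The sum at the leader then vanishes too, because every edge is counted twice in the
total over all vertices (`isBitCirculation_completionLabel`). Conversely, a circulation is
determined by its values off the tree (`eq_completion_of_isBitCirculation`). Thus circulations
correspond to arbitrary labellings of the non-tree edges, and independent fair coins there yield the
uniform distribution (`coinMeasure_completionLabel_eq`).

A circulation vanishes on every cut edge. Any other edge lies on a cycle, and adding multiples of
that cycle shows that at most a fraction `2 ^ (-b)` of the circulations vanish on it
(`card_circulations_zero_mul_le`). Declaring the edges with label zero to be the cut edges therefore
errs only on non-cut edges, and if `|V| |E| ≤ 2 ^ b`, a union bound limits the error probability to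
`1 / |V|`.

To analyse the executions, `sendTime` gives the round of each kind of message in closed or recursive
form, and `config_spec` shows by induction on rounds that states and messages follow this schedule.
There are four kinds, each sent at most once along each direction of an edge, whence `8 |E|`
messages; the last echo comes by round `6 + 4 * diam`. -/

noncomputable section

namespace Congest

/-! ### The breadth-first search tree with smallest possible parents -/

section Tree

variable {V : Type} (N : Network V)

/-- The distance from the leader. -/
def Network.depth (v : V) : ℕ := N.graph.dist N.leader v

/-- `u` is the parent of `v`: among the neighbours of `v` which are closer to the leader, it is the
one with the smallest identifier. -/
def Network.IsParent (u v : V) : Prop :=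
  N.graph.Adj u v ∧ N.depth u + 1 = N.depth v ∧
    ∀ w, N.graph.Adj w v → N.depth w + 1 = N.depth v → N.ID u ≤ N.ID w

namespace Network

lemma depth_leader : N.depth N.leader = 0 := SimpleGraph.dist_self

lemma depth_le_of_adj {u v : V} (h : N.graph.Adj u v) : N.depth v ≤ N.depth u + 1 := by
  have h1 := N.connected.dist_triangle (u := N.leader) (v := u) (w := v)
  rw [SimpleGraph.dist_eq_one_iff_adj.mpr h] at h1
  exact h1

lemma depth_le_diam [Finite V] (v : V) : N.depth v ≤ N.graph.diam := by
  have : Nonempty V := ⟨v⟩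
  exact SimpleGraph.dist_le_diam (SimpleGraph.connected_iff_ediam_ne_top.mp N.connected)

variable {N}

lemma IsParent.ne_leader {u v : V} (h : N.IsParent u v) : v ≠ N.leader := by
  rintro rfl
  have := h.2.1
  simp [N.depth_leader] at this

lemma IsParent.unique {u u' v : V} (h : N.IsParent u v) (h' : N.IsParent u' v) : u = u' :=
  N.ID_injective (le_antisymm (h.2.2 u' h'.1 h'.2.1) (h'.2.2 u h.1 h.2.1))

lemma IsParent.not_symm {u v : V} (h : N.IsParent u v) : ¬ N.IsParent v u := by
  intro h'
  have h1 := h.2.1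
  have h2 := h'.2.1
  omega

/-- The first step of a shortest walk to the leader decreases the depth. -/
lemma exists_adj_depth {v : V} (h : v ≠ N.leader) :
    ∃ u, N.graph.Adj u v ∧ N.depth u + 1 = N.depth v := by
  obtain ⟨p, hp⟩ := N.connected.exists_walk_length_eq_dist v N.leader
  cases p with
  | nil => exact absurd rfl h
  | @cons _ u _ hadj q =>
    refine ⟨u, hadj.symm, ?_⟩
    have h1 := SimpleGraph.dist_le q
    have h2 := N.depth_le_of_adj hadj.symm
    rw [SimpleGraph.Walk.length_cons, SimpleGraph.dist_comm] at hp
    rw [SimpleGraph.dist_comm] at h1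
    simp only [depth] at *
    omega

lemma exists_isParent {v : V} (h : v ≠ N.leader) : ∃ u, N.IsParent u v := by
  classical
  have hne : ∃ n u, N.ID u = n ∧ N.graph.Adj u v ∧ N.depth u + 1 = N.depth v := by
    obtain ⟨u, hu⟩ := exists_adj_depth h
    exact ⟨_, u, rfl, hu⟩
  obtain ⟨u, hu, hadj, hd⟩ := Nat.find_spec hne
  exact ⟨u, hadj, hd, fun w hw hwd => hu ▸ Nat.find_min' hne ⟨w, rfl, hw, hwd⟩⟩

/-- The parent of a vertex; the leader is its own parent. -/
def par (N : Network V) (v : V) : V :=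
  open Classical in if h : v = N.leader then v else (exists_isParent h).choose

lemma isParent_par {v : V} (h : v ≠ N.leader) : N.IsParent (N.par v) v := by
  rw [par, dif_neg h]
  exact (exists_isParent h).choose_spec

lemma isParent_iff {u v : V} : N.IsParent u v ↔ v ≠ N.leader ∧ N.par v = u :=
  ⟨fun h => ⟨h.ne_leader, (isParent_par h.ne_leader).unique h⟩, fun h => h.2 ▸ isParent_par h.1⟩

variable (N)

/-- Depth grows towards the children and is bounded by the diameter. This justifies recursion from
the leaves to the leader. -/
lemma isParent_wellFounded [Finite V] : WellFounded fun u v => N.IsParent v u :=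
  Subrelation.wf (r := InvImage (· < ·) fun v => N.graph.diam - N.depth v)
    (fun {u v} h => by
      have h1 := h.2.1
      have h2 := N.depth_le_diam u
      change N.graph.diam - N.depth u < N.graph.diam - N.depth v
      omega)
    (InvImage.wf _ Nat.lt_wfRel.wf)

/-- The solution of a recursion which determines the value at a vertex from the values at its
children. In the recursion, vertices other than the children have value zero. -/
def treeRec [Finite V] {α : Type*} [Zero α] (F : V → (V → α) → α) : V → α :=
  open Classical in
  N.isParent_wellFounded.fix fun v ih => F v fun u => if h : N.IsParent v u then ih u h else 0

open Classical in
lemma treeRec_eq [Finite V] {α : Type*} [Zero α] (F : V → (V → α) → α) (v : V) :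
    N.treeRec F v = F v fun u => if N.IsParent v u then N.treeRec F u else 0 := by
  rw [treeRec, WellFounded.fix_eq]
  congr 1

lemma depth_induction {p : V → Prop} (h0 : p N.leader)
    (h1 : ∀ u v, N.IsParent u v → p u → p v) (v : V) : p v := by
  induction hn : N.depth v using Nat.strong_induction_on generalizing v with
  | _ n ih =>
    by_cases h : v = N.leader
    · exact h ▸ h0
    · have h2 := isParent_par h
      have h3 := h2.2.1
      exact h1 _ _ h2 (ih _ (by omega) _ rfl)

lemma height_induction [Finite V] {p : V → Prop}
    (h : ∀ v, (∀ u, N.IsParent v u → p u) → p v) (v : V) : p v :=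
  N.isParent_wellFounded.induction v h

/-- The tree formed by the edges between the vertices and their parents. -/
def bfsTree : SimpleGraph V where
  Adj u v := N.IsParent u v ∨ N.IsParent v u
  symm := ⟨fun _ _ h => h.symm⟩
  loopless := ⟨fun v h => N.graph.loopless.irrefl v (by rcases h with h | h <;> exact h.1)⟩

lemma bfsTree_le : N.bfsTree ≤ N.graph := by
  rintro u v (h | h)
  · exact h.1
  · exact h.1.symm

lemma exists_bfsTree_walk (v : V) : ∃ p : N.bfsTree.Walk N.leader v, p.length = N.depth v := by
  induction v using N.depth_induction with
  | h0 => exact ⟨.nil, N.depth_leader.symm⟩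
  | h1 u v h ih =>
    obtain ⟨p, hp⟩ := ih
    have hadj : N.bfsTree.Adj u v := Or.inl h
    exact ⟨p.concat hadj, by rw [SimpleGraph.Walk.length_concat, hp, h.2.1]⟩

lemma bfsTree_connected : N.bfsTree.Connected where
  preconnected u v := by
    obtain ⟨p, -⟩ := N.exists_bfsTree_walk u
    obtain ⟨q, -⟩ := N.exists_bfsTree_walk v
    exact ⟨p.reverse.append q⟩
  nonempty := ⟨N.leader⟩

lemma bfsTree_dist (v : V) : N.bfsTree.dist N.leader v = N.depth v := by
  refine le_antisymm ?_ (SimpleGraph.Reachable.dist_anti N.bfsTree_le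
    (N.bfsTree_connected.preconnected _ _))
  obtain ⟨p, hp⟩ := N.exists_bfsTree_walk v
  exact hp ▸ SimpleGraph.dist_le p

/-- Every edge joins some vertex other than the leader to its parent, so there are at most `|V| - 1`
edges; a connected graph with so few edges is a tree. -/
lemma bfsTree_isTree [Finite V] : N.bfsTree.IsTree := by
  classical
  have := Fintype.ofFinite V
  refine (SimpleGraph.isTree_iff_connected_and_card).mpr ⟨N.bfsTree_connected, ?_⟩
  have h1 := N.bfsTree_connected.card_vert_le_card_edgeSet_add_one
  refine le_antisymm ?_ h1
  have h2 : N.bfsTree.edgeSet ⊆ (fun v => s(N.par v, v)) '' {v | v ≠ N.leader} := by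
    intro e
    induction e with
    | h u v =>
      rintro (h | h)
      · exact ⟨v, h.ne_leader, by simp only [(isParent_iff.mp h).2]⟩
      · exact ⟨u, h.ne_leader, by simp only [(isParent_iff.mp h).2]; exact Sym2.eq_swap⟩
  have h3 : N.bfsTree.edgeSet.ncard ≤ {v | v ≠ N.leader}.ncard :=
    (Set.ncard_le_ncard h2).trans (Set.ncard_image_le)
  have h4 : {v | v ≠ N.leader}.ncard + 1 = Nat.card V := by
    have := Set.ncard_add_ncard_compl {N.leader}
    rw [Set.ncard_singleton] at this
    rw [← this, add_comm]
    rfl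
  rw [Nat.card_coe_set_eq]
  omega

lemma isBFSTree_bfsTree [Finite V] : IsBFSTree N.graph N.leader N.bfsTree :=
  ⟨N.bfsTree_le, N.bfsTree_isTree, N.bfsTree_dist⟩

end Network

end Tree

/-! ### Circulations as labellings with vanishing sums -/

section Circulation

lemma bool_add_self (x : Bool) : x + x = 0 := by cases x <;> rfl

lemma sum_bool_eq_zero_iff {ι : Type*} (s : Finset ι) (f : ι → Bool) :
    ∑ j ∈ s, f j = 0 ↔ Even (s.filter fun j => f j = true).card := by
  classical
  induction s using Finset.induction_on with
  | empty => simp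
  | insert a s ha ih =>
    rw [Finset.sum_insert ha, Finset.filter_insert]
    cases h : f a with
    | false =>
      have : (false : Bool) + ∑ j ∈ s, f j = ∑ j ∈ s, f j := zero_add _
      simpa [this] using ih
    | true =>
      rw [if_pos rfl, Finset.card_insert_of_notMem (by simp [ha]), Nat.even_add_one, ← ih]
      generalize ∑ j ∈ s, f j = x
      cases x <;> decide

/-- The handshake lemma modulo two: the terms at `(u, v)` and `(v, u)` cancel, since addition on
`Bool` is exclusive or. -/
lemma sum_sum_symm_eq_zero {V : Type*} (s : Finset V) (a : V → V → Bool)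
    (hs : ∀ u v, a u v = a v u) (hd : ∀ v, a v v = 0) : ∑ v ∈ s, ∑ u ∈ s, a v u = 0 := by
  rw [← Finset.sum_product']
  refine Finset.sum_involution (fun p _ => p.swap) ?_ ?_ ?_ ?_
  · rintro ⟨u, v⟩ -
    simp only [Prod.swap_prod_mk]
    rw [hs u v, bool_add_self]
  · rintro ⟨u, v⟩ - h h'
    simp only [Prod.swap_prod_mk, Prod.mk.injEq] at h'
    exact h (by simp only [h'.1, hd])
  · rintro ⟨u, v⟩ h
    simpa [and_comm] using h
  · rintro ⟨u, v⟩ -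
    rfl

variable {V : Type} (G : SimpleGraph V) {b : ℕ}

open Classical in
/-- The labels of an edge labelling as a function of two vertices, zero off the edges. -/
def edgeVal (φ : G.edgeSet → Fin b → Bool) (u v : V) (i : Fin b) : Bool :=
  if h : G.Adj u v then φ ⟨s(u, v), h⟩ i else 0

variable {G}

lemma label_swap {α : Type*} (φ : G.edgeSet → α) {u v : V} (h : G.Adj u v) :
    φ ⟨s(u, v), h⟩ = φ ⟨s(v, u), h.symm⟩ := by
  have : (⟨s(u, v), h⟩ : G.edgeSet) = ⟨s(v, u), h.symm⟩ := Subtype.ext Sym2.eq_swap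
  rw [this]

lemma edgeVal_of_adj (φ : G.edgeSet → Fin b → Bool) {u v : V} (h : G.Adj u v) (i : Fin b) :
    edgeVal G φ u v i = φ ⟨s(u, v), h⟩ i := dif_pos h

lemma edgeVal_of_not_adj (φ : G.edgeSet → Fin b → Bool) {u v : V} (h : ¬ G.Adj u v) (i : Fin b) :
    edgeVal G φ u v i = 0 := dif_neg h

lemma edgeVal_comm (φ : G.edgeSet → Fin b → Bool) (u v : V) (i : Fin b) :
    edgeVal G φ u v i = edgeVal G φ v u i := by
  by_cases h : G.Adj u v
  · rw [edgeVal_of_adj φ h, edgeVal_of_adj φ h.symm, label_swap φ h]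
  · rw [edgeVal_of_not_adj φ h, edgeVal_of_not_adj φ (fun h' => h h'.symm)]

lemma edgeVal_self (φ : G.edgeSet → Fin b → Bool) (v : V) (i : Fin b) :
    edgeVal G φ v v i = 0 := edgeVal_of_not_adj φ (G.loopless.irrefl v) i

lemma isBitCirculation_iff [Fintype V] (φ : G.edgeSet → Fin b → Bool) :
    IsBitCirculation G b φ ↔ ∀ i v, ∑ u, edgeVal G φ v u i = 0 := by
  classical
  refine forall_congr' fun i => ?_
  have key : ∀ v, Even {e ∈ Subtype.val '' {e | φ e i = true} | v ∈ e}.ncard ↔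
      ∑ u, edgeVal G φ v u i = 0 := by
    intro v
    have h1 : {e ∈ Subtype.val '' {e | φ e i = true} | v ∈ e} =
        (fun u => s(v, u)) '' {u | edgeVal G φ v u i = true} := by
      ext e
      constructor
      · rintro ⟨⟨⟨e, he⟩, hφ, rfl⟩, u, rfl⟩
        exact ⟨u, by rw [Set.mem_ofPred_eq, edgeVal_of_adj φ he]; exact hφ, rfl⟩
      · rintro ⟨u, hu, rfl⟩
        have hadj : G.Adj v u := by
          by_contra h
          rw [Set.mem_ofPred_eq, edgeVal_of_not_adj φ h] at hu
          exact Bool.false_ne_true hu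
        rw [Set.mem_ofPred_eq, edgeVal_of_adj φ hadj] at hu
        exact ⟨⟨⟨_, hadj⟩, hu, rfl⟩, Sym2.mem_mk_left v u⟩
    rw [h1, Set.ncard_image_of_injective _ fun u u' h => Sym2.congr_right.mp h,
      sum_bool_eq_zero_iff, ← Set.ncard_coe_finset]
    simp
  simp only [IsBinaryCirculation, key, and_iff_right_iff_imp]
  rintro - e ⟨⟨e, he⟩, -, rfl⟩
  exact he

lemma IsBitCirculation.add [Fintype V] {φ ψ : G.edgeSet → Fin b → Bool}
    (hφ : IsBitCirculation G b φ) (hψ : IsBitCirculation G b ψ) : IsBitCirculation G b (φ + ψ) := by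
  rw [isBitCirculation_iff] at *
  intro i v
  have : ∀ u, edgeVal G (φ + ψ) v u i = edgeVal G φ v u i + edgeVal G ψ v u i := by
    intro u
    by_cases h : G.Adj v u
    · simp only [edgeVal_of_adj _ h, Pi.add_apply]
    · simp only [edgeVal_of_not_adj _ h, add_zero]
  simp only [this, Finset.sum_add_distrib, hφ, hψ, add_zero]

/-! ### Cut edges -/

lemma isCutEdge_iff (hG : G.Connected) {u v : V} (h : G.Adj u v) :
    IsCutEdge G s(u, v) ↔ G.IsBridge s(u, v) := by
  constructor
  · intro h1
    by_contra h2
    exact h1.2 (hG.connected_delete_edge_of_not_isBridge h2)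
  · exact fun h1 => ⟨h, fun h2 => h1 (h2.preconnected u v)⟩

/-- Add the vanishing sums at all vertices on one side of the cut. Edges inside that side cancel,
and the cut edge is the only one that leaves it. -/
lemma IsBitCirculation.eq_zero_of_isCutEdge [Fintype V] {φ : G.edgeSet → Fin b → Bool}
    (hφ : IsBitCirculation G b φ) (hG : G.Connected) {u v : V} (h : G.Adj u v)
    (hcut : IsCutEdge G s(u, v)) (i : Fin b) : φ ⟨s(u, v), h⟩ i = 0 := by
  classical
  rw [isCutEdge_iff hG h] at hcut
  rw [isBitCirculation_iff] at hφ
  set S : Finset V := Finset.univ.filter fun w => (G.deleteEdges {s(u, v)}).Reachable u w with hS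
  have hu : u ∈ S := by simp [hS]
  have hv : v ∈ Sᶜ := by simpa [hS, SimpleGraph.isBridge_iff] using hcut
  have h1 : ∑ w ∈ S, ∑ x, edgeVal G φ w x i = 0 := Finset.sum_eq_zero fun w _ => hφ i w
  have h2 : ∑ w ∈ S, ∑ x ∈ Sᶜ, edgeVal G φ w x i = edgeVal G φ u v i := by
    rw [Finset.sum_eq_single_of_mem u hu, Finset.sum_eq_single_of_mem v hv]
    all_goals
      have key : ∀ w ∈ S, ∀ x ∈ Sᶜ, ¬ (w = u ∧ x = v) → edgeVal G φ w x i = 0 := by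
        intro w hw x hx hne
        refine edgeVal_of_not_adj φ (fun hadj => ?_) i
        simp only [hS, Finset.mem_compl, Finset.mem_filter, Finset.mem_univ, true_and] at hw hx
        refine hx (hw.trans (SimpleGraph.Adj.reachable ?_))
        rw [SimpleGraph.deleteEdges_adj]
        refine ⟨hadj, fun he => ?_⟩
        rcases Sym2.eq_iff.mp he with h | h
        · exact hne h
        · exact hcut (h.1 ▸ hw)
    · exact fun x hx hne => key u hu x hx fun h => hne h.2
    · exact fun w hw hne => Finset.sum_eq_zero fun x hx => key w hw x hx fun h => hne h.1
  have h3 := sum_sum_symm_eq_zero S (fun w x => edgeVal G φ w x i)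
    (fun w x => edgeVal_comm φ w x i) (fun w => edgeVal_self φ w i)
  rw [← edgeVal_of_adj φ h, ← h2, ← h1]
  simp only [← Finset.sum_add_sum_compl S, Finset.sum_add_distrib]
  rw [h3, zero_add]

/-- `C` is the indicator of a cycle through `e`, which has an even number of edges at each vertex;
`s` scales it independently in each bit. -/
lemma exists_circulation_of_not_isCutEdge (hG : G.Connected) {e : Sym2 V} (he : e ∈ G.edgeSet)
    (hcut : ¬ IsCutEdge G e) :
    ∃ C : G.edgeSet → Bool, C ⟨e, he⟩ = true ∧
      ∀ (b : ℕ) (s : Fin b → Bool), IsBitCirculation G b fun f i => C f && s i := by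
  classical
  have hb : ¬ G.IsBridge e := by
    induction e with
    | h u v => exact fun h => hcut ((isCutEdge_iff hG he).mpr h)
  rw [SimpleGraph.isBridge_iff_forall_cycle_notMem he] at hb
  push Not at hb
  obtain ⟨w, p, hp, hmem⟩ := hb
  refine ⟨fun f => decide (f.1 ∈ p.edges), by simpa using hmem, fun b s i => ?_⟩
  refine ⟨by rintro _ ⟨⟨f, hf⟩, -, rfl⟩; exact hf, fun v => ?_⟩
  cases hs : s i with
  | false => simp [hs]
  | true =>
    have h1 := (hp.isTrail.even_countP_edges_iff v).mpr fun h => absurd rfl h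
    have h2 : {f ∈ Subtype.val '' {f : G.edgeSet | (decide (f.1 ∈ p.edges) && true) = true} |
        v ∈ f} = ((p.edges.filter fun f => v ∈ f).toFinset : Finset (Sym2 V)) := by
      ext f
      simp only [Bool.and_true, decide_eq_true_eq, Set.mem_ofPred_eq, Set.mem_image, Subtype.exists,
        exists_and_left, exists_prop, exists_eq_right_right, List.coe_toFinset, List.mem_filter]
      exact ⟨fun h => ⟨h.1.1, h.2⟩, fun h => ⟨⟨h.1, p.edges_subset_edgeSet h.1⟩, h.2⟩⟩
    simp only [hs]
    rw [h2, Set.ncard_coe_finset, List.toFinset_card_of_nodup (hp.isTrail.edges_nodup.filter _),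
      ← List.countP_eq_length_filter]
    exact h1

/-- With a cycle `C` through `e`, the map `(ψ, s) ↦ ψ + C s` is injective: as `ψ` vanishes at `e`,
the value of the sum at `e` is `s`, and then `ψ` can be recovered. -/
lemma card_circulations_zero_mul_le [Fintype V] (hG : G.Connected) {e : Sym2 V}
    (he : e ∈ G.edgeSet) (hcut : ¬ IsCutEdge G e) :
    Nat.card {ψ : G.edgeSet → Fin b → Bool // IsBitCirculation G b ψ ∧ ψ ⟨e, he⟩ = 0} * 2 ^ b ≤
      Nat.card {ψ : G.edgeSet → Fin b → Bool // IsBitCirculation G b ψ} := by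
  classical
  obtain ⟨C, hC, hcirc⟩ := exists_circulation_of_not_isCutEdge hG he hcut
  have h2 : (2 : ℕ) ^ b = Nat.card (Fin b → Bool) := by simp
  rw [h2, ← Nat.card_prod]
  refine Nat.card_le_card_of_injective
    (fun p => ⟨p.1.1 + fun f i => C f && p.2 i, p.1.2.1.add (hcirc b p.2)⟩) ?_
  rintro ⟨⟨ψ, hψ, hψe⟩, s⟩ ⟨⟨ψ', hψ', hψe'⟩, s'⟩ h
  simp only [Subtype.mk.injEq] at h
  have hs : s = s' := by
    have := congrFun h ⟨e, he⟩
    simpa [hψe, hψe', hC] using this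
  subst hs
  have := add_right_cancel h
  subst this
  rfl

end Circulation

/-! ### Completing a labelling of the non-tree edges -/

section Completion

open Classical

variable {V : Type} [Fintype V] (N : Network V) {b : ℕ}

namespace Network

/-- The label of the edge from a vertex to its parent, if the labels off the tree are given by `x`
and the labels of the edges at each vertex other than the leader have sum zero. -/
def flow (x : V → V → Fin b → Bool) : V → Fin b → Bool :=
  N.treeRec fun v g => ∑ u, if N.graph.Adj v u ∧ ¬ N.IsParent u v then
    (if N.IsParent v u then g u else x v u) else 0

lemma flow_eq (x : V → V → Fin b → Bool) (v : V) :
    N.flow x v = ∑ u, if N.graph.Adj v u ∧ ¬ N.IsParent u v then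
      (if N.IsParent v u then N.flow x u else x v u) else 0 := by
  rw [flow, treeRec_eq]
  refine Finset.sum_congr rfl fun u _ => ?_
  beta_reduce
  split_ifs <;> rfl

/-- The extension of a labelling `x` of the non-tree edges to all edges. -/
def completion (x : V → V → Fin b → Bool) (u v : V) : Fin b → Bool :=
  if N.IsParent u v then N.flow x v else if N.IsParent v u then N.flow x u else x u v

lemma completion_comm {x : V → V → Fin b → Bool} (hx : ∀ u v, x u v = x v u) (u v : V) :
    N.completion x u v = N.completion x v u := by
  unfold completion
  by_cases h : N.IsParent u v
  · rw [if_pos h, if_neg h.not_symm, if_pos h]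
  · rw [if_neg h, if_neg h, hx]

/-- The completion as a labelling of the edges. -/
def completionLabel {x : V → V → Fin b → Bool} (hx : ∀ u v, x u v = x v u)
    (e : N.graph.edgeSet) : Fin b → Bool :=
  Sym2.lift ⟨N.completion x, N.completion_comm hx⟩ e.1

/-- The label of the parent edge is the sum of the other labels at `v`, and equal bits cancel. -/
lemma sum_completion {x : V → V → Fin b → Bool} {v : V} (hv : v ≠ N.leader) (i : Fin b) :
    ∑ u, (if N.graph.Adj v u then N.completion x v u i else 0) = 0 := by
  have h := isParent_par hv
  rw [← Finset.add_sum_erase _ _ (Finset.mem_univ (N.par v)), if_pos h.1.symm]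
  have h1 : N.completion x v (N.par v) i = N.flow x v i := by
    rw [completion, if_neg h.not_symm, if_pos h]
  rw [h1, flow_eq, Finset.sum_apply, ← Finset.add_sum_erase _ _ (Finset.mem_univ (N.par v)),
    if_neg (fun h' => h'.2 h), Pi.zero_apply, zero_add, ← Finset.sum_add_distrib]
  refine Finset.sum_eq_zero fun u hu => ?_
  have hu' : ¬ N.IsParent u v := fun h' => (Finset.ne_of_mem_erase hu) (h'.unique h)
  by_cases hadj : N.graph.Adj v u
  · rw [if_pos ⟨hadj, hu'⟩, if_pos hadj, completion, if_neg hu']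
    split_ifs <;> exact bool_add_self _
  · rw [if_neg (fun h' => hadj h'.1), if_neg hadj]
    rfl

lemma isBitCirculation_completionLabel {x : V → V → Fin b → Bool} (hx : ∀ u v, x u v = x v u) :
    IsBitCirculation N.graph b (N.completionLabel hx) := by
  rw [isBitCirculation_iff]
  intro i
  have h1 : ∀ v ≠ N.leader, ∑ u, edgeVal N.graph (N.completionLabel hx) v u i = 0 :=
    fun v hv => N.sum_completion hv i
  intro v
  by_cases hv : v = N.leader
  · subst hv
    -- The sums at all vertices add up to zero, so the leader's sum vanishes once the others do.
    have h2 := sum_sum_symm_eq_zero Finset.univ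
      (fun w u => edgeVal N.graph (N.completionLabel hx) w u i)
      (fun w x => edgeVal_comm _ w x i) (fun w => edgeVal_self _ w i)
    rwa [Finset.sum_eq_single_of_mem N.leader (Finset.mem_univ _) fun v _ hv => h1 v hv] at h2
  · exact h1 v hv

/-- Going from the leaves to the leader, the vanishing sum at each vertex forces the label of its
parent edge. -/
lemma eq_completion_of_isBitCirculation {φ : N.graph.edgeSet → Fin b → Bool}
    (hφ : IsBitCirculation N.graph b φ) {x : V → V → Fin b → Bool}
    (hx : ∀ u v (h : N.graph.Adj u v), ¬ N.bfsTree.Adj u v → φ ⟨s(u, v), h⟩ = x u v)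
    (u v : V) (h : N.graph.Adj u v) : φ ⟨s(u, v), h⟩ = N.completion x u v := by
  rw [isBitCirculation_iff] at hφ
  have key : ∀ v u (h : N.IsParent u v), φ ⟨s(v, u), h.1.symm⟩ = N.flow x v := by
    intro v
    induction v using N.height_induction with
    | h v ih =>
      intro u h
      funext i
      have h1 := hφ i v
      rw [← Finset.add_sum_erase _ _ (Finset.mem_univ u), edgeVal_of_adj _ h.1.symm] at h1
      rw [flow_eq, Finset.sum_apply, ← Finset.add_sum_erase _ _ (Finset.mem_univ u),
        if_neg (fun h' => h'.2 h), Pi.zero_apply, zero_add]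
      have h2 : ∀ a c : Bool, a + c = 0 → a = c := by decide
      rw [h2 _ _ h1]
      refine Finset.sum_congr rfl fun w hw => ?_
      have hw' : ¬ N.IsParent w v := fun h' => (Finset.ne_of_mem_erase hw) (h'.unique h)
      by_cases hadj : N.graph.Adj v w
      · rw [if_pos ⟨hadj, hw'⟩, edgeVal_of_adj _ hadj]
        by_cases hc : N.IsParent v w
        · rw [if_pos hc, ← ih w hc v hc, label_swap φ hadj]
        · rw [if_neg hc, hx v w hadj fun h' => h'.elim hc hw']
      · rw [if_neg (fun h' => hadj h'.1), edgeVal_of_not_adj _ hadj]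
        rfl
  unfold completion
  split_ifs with h1 h2
  · rw [← key v u h1, label_swap φ h]
  · exact key u v h2
  · exact hx u v h fun h' => h'.elim h1 h2

/-- The edges of the network that are not in the tree. -/
abbrev NonTreeEdge : Type := {e : Sym2 V // e ∈ N.graph.edgeSet ∧ e ∉ N.bfsTree.edgeSet}

/-- Restriction to the non-tree edges is a bijection from circulations to arbitrary labellings, with
completion as its inverse. -/
lemma card_circulations : Nat.card {φ : N.graph.edgeSet → Fin b → Bool //
    IsBitCirculation N.graph b φ} = 2 ^ (Fintype.card (N.NonTreeEdge × Fin b)) := by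
  have h : (2 : ℕ) ^ (Fintype.card (N.NonTreeEdge × Fin b)) =
      Nat.card (N.NonTreeEdge → Fin b → Bool) := by
    rw [Nat.card_congr (Equiv.curry _ _ _).symm]
    simp
  rw [h]
  refine Nat.card_congr (Equiv.ofBijective (fun φ e => φ.1 ⟨e.1, e.2.1⟩) ⟨?_, ?_⟩)
  · rintro ⟨φ, hφ⟩ ⟨ψ, hψ⟩ h
    have h1 : ∀ u v (h : N.graph.Adj u v), ¬ N.bfsTree.Adj u v →
        φ ⟨s(u, v), h⟩ = fun i => edgeVal N.graph ψ u v i := by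
      intro u v hadj hn
      funext i
      rw [edgeVal_of_adj _ hadj]
      exact congrFun (congrFun h ⟨s(u, v), hadj, hn⟩) i
    have h2 : ∀ u v (h : N.graph.Adj u v), ¬ N.bfsTree.Adj u v →
        ψ ⟨s(u, v), h⟩ = fun i => edgeVal N.graph ψ u v i := by
      intro u v hadj hn
      funext i
      rw [edgeVal_of_adj _ hadj]
    refine Subtype.ext (funext ?_)
    rintro ⟨e, he⟩
    induction e with
    | h u v =>
      exact (N.eq_completion_of_isBitCirculation hφ h1 u v he).trans
        (N.eq_completion_of_isBitCirculation hψ h2 u v he).symm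
  · intro y
    let g : Sym2 V → Fin b → Bool := fun e =>
      if h : e ∈ N.graph.edgeSet ∧ e ∉ N.bfsTree.edgeSet then y ⟨e, h⟩ else 0
    have hx : ∀ u v, (fun u v => g s(u, v)) u v = (fun u v => g s(u, v)) v u :=
      fun u v => congrArg g Sym2.eq_swap
    refine ⟨⟨N.completionLabel hx, N.isBitCirculation_completionLabel hx⟩, funext ?_⟩
    rintro ⟨e, he⟩
    induction e with
    | h u v =>
      change N.completion _ u v = _
      rw [completion, if_neg (fun h => he.2 (Or.inl h)), if_neg (fun h => he.2 (Or.inr h))]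
      exact dif_pos he

end Network

end Completion

/-! ### The schedule of a flood followed by an echo -/

/-- The kinds of messages: the first component tells whether it is sent in the second phase, the
second one whether it is an echo, sent to the parent only, or part of a flood, sent to all
neighbours. -/
abbrev Kind := Bool × Bool

section Schedule

open Classical

variable {V : Type} [Fintype V] (N : Network V)

namespace Network

/-- The round in which a vertex sends its echo, if the leader starts the flood in round `base`. -/
def echoTime (base : ℕ) : V → ℕ :=
  N.treeRec fun v g => max (base + N.depth v + 1) (Finset.univ.sup fun u =>
    max (if N.graph.Adj u v then base + N.depth u + 1 else 0)
      (if N.IsParent v u then g u + 1 else 0))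

variable {N}

/-- These are the conditions that `NodeState.Ready` tests locally: the own flood is sent, all
neighbours' floods have arrived, and so have the echoes of all children. -/
lemma echoTime_le_iff {base t : ℕ} {v : V} : N.echoTime base v ≤ t + 1 ↔
    base + N.depth v ≤ t ∧ (∀ u, N.graph.Adj u v → base + N.depth u ≤ t) ∧
      ∀ u, N.IsParent v u → N.echoTime base u ≤ t := by
  rw [echoTime, treeRec_eq, ← echoTime, max_le_iff, Finset.sup_le_iff, Nat.add_le_add_iff_right,
    ← forall_and]
  refine and_congr_right fun _ => forall_congr' fun u => ?_
  simp only [Finset.mem_univ, true_implies, max_le_iff]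
  refine and_congr ?_ ?_ <;> split_ifs with h <;> simp [h]

lemma lt_echoTime (base : ℕ) (v : V) : base + N.depth v < N.echoTime base v := by
  rw [echoTime, treeRec_eq]
  exact (Nat.lt_succ_self _).trans_le (le_max_left _ _)

lemma IsParent.echoTime_lt {base : ℕ} {u v : V} (h : N.IsParent v u) :
    N.echoTime base u < N.echoTime base v := by
  have h1 := N.lt_echoTime base v
  obtain ⟨t, ht⟩ : ∃ t, N.echoTime base v = t + 1 := ⟨_, (Nat.succ_pred (by omega)).symm⟩
  have := (echoTime_le_iff.mp ht.le).2.2 u h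
  omega

lemma echoTime_le_leader (base : ℕ) (v : V) : N.echoTime base v ≤ N.echoTime base N.leader := by
  induction v using N.depth_induction with
  | h0 => exact le_rfl
  | h1 u v h ih => exact h.echoTime_lt.le.trans ih

/-- Induction from the leaves: an echo climbs one level per round at worst, while the depth drops by
one, so the left-hand side keeps its bound. -/
lemma echoTime_le (base : ℕ) (v : V) :
    N.echoTime base v + N.depth v ≤ base + 2 + 2 * N.graph.diam := by
  induction v using N.height_induction with
  | h v ih =>
    have h0 := N.depth_le_diam v
    obtain ⟨c, hc⟩ := Nat.exists_eq_add_of_le h0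
    have : N.echoTime base v ≤ (base + 1 + N.depth v + 2 * c) + 1 := by
      rw [echoTime_le_iff]
      refine ⟨by omega, fun u hu => ?_, fun u hu => ?_⟩
      · have := N.depth_le_of_adj hu.symm
        omega
      · have h1 := ih u hu
        have h2 := hu.2.1
        omega
    omega

variable (N)

/-- The round in which the leader starts the flood of a phase. -/
def startTime (k : Bool) : ℕ := if k then N.echoTime 1 N.leader + 1 else 1

/-- The round in which a vertex sends its messages of a given kind. -/
def sendTime (κ : Kind) (v : V) : ℕ :=
  if κ.2 then N.echoTime (N.startTime κ.1) v else N.startTime κ.1 + N.depth v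

/-- `u` sends its messages of kind `κ` to the neighbour `v`. -/
def IsRecipient (κ : Kind) (u v : V) : Prop := κ.2 = true → N.IsParent v u

variable {N}

lemma sendTime_flood (k : Bool) (v : V) : N.sendTime (k, false) v = N.startTime k + N.depth v := rfl

lemma sendTime_echo (k : Bool) (v : V) : N.sendTime (k, true) v = N.echoTime (N.startTime k) v :=
  rfl

lemma sendTime_flood_lt_echo (k : Bool) (v : V) :
    N.sendTime (k, false) v < N.sendTime (k, true) v := N.lt_echoTime _ v

/-- The leader's echo is the last of the first phase, and the second flood starts one round after
it. -/
lemma sendTime_echo_lt_flood (v : V) : N.sendTime (false, true) v < N.sendTime (true, false) v := by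
  have := N.echoTime_le_leader 1 v
  simp only [sendTime, startTime]
  simp
  omega

lemma sendTime_echo_le_iff {k : Bool} {t : ℕ} {v : V} : N.sendTime (k, true) v ≤ t + 1 ↔
    N.sendTime (k, false) v ≤ t ∧ (∀ u, N.graph.Adj u v → N.sendTime (k, false) u ≤ t) ∧
      ∀ u, N.IsParent v u → N.sendTime (k, true) u ≤ t := echoTime_le_iff

lemma sendTime_pos (κ : Kind) (v : V) : 0 < N.sendTime κ v := by
  have h0 : 0 < N.sendTime (false, false) v := by simp [sendTime, startTime]
  have h1 := N.sendTime_flood_lt_echo false v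
  have h2 := N.sendTime_echo_lt_flood v
  have h3 := N.sendTime_flood_lt_echo true v
  rcases κ with ⟨_ | _, _ | _⟩ <;> omega

/-- This is why one message per neighbour and round suffices: no two kinds ever compete for the same
round. -/
lemma sendTime_injective (v : V) : Function.Injective fun κ => N.sendTime κ v := by
  have h1 := N.sendTime_flood_lt_echo false v
  have h2 := N.sendTime_echo_lt_flood v
  have h3 := N.sendTime_flood_lt_echo true v
  rintro ⟨_ | _, _ | _⟩ ⟨_ | _, _ | _⟩ h <;> first | rfl | (dsimp only at h; omega)

lemma sendTime_le_last (κ : Kind) (v : V) : N.sendTime κ v ≤ N.sendTime (true, true) v := by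
  have h1 := N.sendTime_flood_lt_echo false v
  have h2 := N.sendTime_echo_lt_flood v
  have h3 := N.sendTime_flood_lt_echo true v
  rcases κ with ⟨_ | _, _ | _⟩ <;> omega

lemma sendTime_le (κ : Kind) (v : V) : N.sendTime κ v ≤ 6 + 4 * N.graph.diam := by
  refine (sendTime_le_last κ v).trans ?_
  have h1 := N.echoTime_le (N.echoTime 1 N.leader + 1) v
  have h2 := N.echoTime_le 1 N.leader
  simp only [sendTime, startTime, if_true]
  omega

/-! ### Counting vertices and edges -/

variable (N)

/-- The number of vertices and the sum of the degrees in the subtree below a vertex. -/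
def subtreeCount : V → ℕ × ℕ :=
  N.treeRec fun v g => (1, (N.view v).nbrs.card) + ∑ u, g u

lemma subtreeCount_eq (v : V) : N.subtreeCount v =
    (1, (N.view v).nbrs.card) + ∑ u, if N.IsParent v u then N.subtreeCount u else 0 :=
  N.treeRec_eq _ v

lemma mem_nbrs {u v : V} : N.ID u ∈ (N.view v).nbrs ↔ N.graph.Adj v u := by
  simp [view, N.ID_injective.eq_iff]

lemma exists_of_mem_nbrs {j : ℕ} {v : V} (h : j ∈ (N.view v).nbrs) :
    ∃ u, N.ID u = j ∧ N.graph.Adj v u := by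
  obtain ⟨u, hu, rfl⟩ := Finset.mem_image.mp h
  exact ⟨u, rfl, (Finset.mem_filter.mp hu).2⟩

lemma sum_nbrs {α : Type*} [AddCommMonoid α] (v : V) (g : ℕ → α) :
    ∑ j ∈ (N.view v).nbrs, g j = ∑ u, if N.graph.Adj v u then g (N.ID u) else 0 := by
  rw [view, Finset.sum_image (fun _ _ _ _ h => N.ID_injective h), Finset.sum_filter]

lemma sum_card_nbrs : ∑ v, (N.view v).nbrs.card = 2 * N.numEdges := by
  have h1 : ∀ v, (N.view v).nbrs.card = N.graph.degree v := by
    intro v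
    rw [view, Finset.card_image_of_injective _ N.ID_injective,
      ← SimpleGraph.card_neighborFinset_eq_degree]
    congr 1
    ext u
    simp
  simp only [h1]
  rw [SimpleGraph.sum_degrees_eq_twice_card_edges, numEdges, ← SimpleGraph.coe_edgeFinset,
    Set.ncard_coe_finset]

/-- Sum the recursion over all vertices. Every vertex except the leader has exactly one parent and
thus appears once on the right; cancelling these terms leaves the leader's count. -/
lemma subtreeCount_leader : N.subtreeCount N.leader = (Fintype.card V, 2 * N.numEdges) := by
  have h1 : ∑ v, N.subtreeCount v = (Fintype.card V, 2 * N.numEdges) +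
      ∑ u ∈ Finset.univ.erase N.leader, N.subtreeCount u := by
    conv_lhs => enter [2, v]; rw [subtreeCount_eq]
    rw [Finset.sum_add_distrib, Finset.sum_comm]
    congr 1
    · rw [← N.sum_card_nbrs]
      ext <;> simp [Prod.fst_sum, Prod.snd_sum]
    · rw [← Finset.add_sum_erase _ _ (Finset.mem_univ N.leader)]
      have h2 : ∑ v, (if N.IsParent v N.leader then N.subtreeCount N.leader else 0) = 0 :=
        Finset.sum_eq_zero fun v _ => if_neg fun h => h.ne_leader rfl
      rw [h2, zero_add]
      refine Finset.sum_congr rfl fun u hu => ?_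
      have h3 := isParent_par (Finset.ne_of_mem_erase hu)
      rw [Finset.sum_eq_single_of_mem (N.par u) (Finset.mem_univ _) fun v _ hv =>
        if_neg fun h => hv (h.unique h3), if_pos h3]
  rw [← Finset.add_sum_erase _ _ (Finset.mem_univ N.leader)] at h1
  exact add_right_cancel h1

lemma subtreeCount_le (v : V) : N.subtreeCount v ≤ (Fintype.card V, 2 * N.numEdges) := by
  rw [← subtreeCount_leader]
  induction v using N.depth_induction with
  | h0 => exact le_rfl
  | h1 u v h ih =>
    refine le_trans ?_ ih
    rw [N.subtreeCount_eq u]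
    refine le_add_left ?_
    have := Finset.single_le_sum (f := fun w => if N.IsParent u w then N.subtreeCount w else 0)
      (fun w _ => zero_le) (Finset.mem_univ v)
    simpa only [if_pos h] using this

end Network

end Schedule

/-! ### The algorithm -/

/-- The bit string which encodes a pair of numbers. -/
def encodePair (x : ℕ × ℕ) : Msg := (Nat.pair x.1 x.2).bits

/-- The pair of numbers which is encoded by a bit string. -/
def decodePair (l : Msg) : ℕ × ℕ := Nat.unpair (l.foldr Nat.bit 0)

lemma foldr_bit_bits (n : ℕ) : n.bits.foldr Nat.bit 0 = n := by
  induction n using Nat.binaryRec' with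
  | zero => simp
  | bit c n h ih => rw [Nat.bits_append_bit n c h, List.foldr_cons, ih]

lemma decodePair_encodePair (x : ℕ × ℕ) : decodePair (encodePair x) = x := by
  rw [decodePair, encodePair, foldr_bit_bits, Nat.unpair_pair]

/-- The memory of a vertex: what it knew initially, the kinds of messages that it has sent, the
messages that it has received, its parent, and its own random labels for the incident edges. -/
structure NodeState where
  view : LocalView
  done : Kind → Bool
  got : Kind → ℕ → Option Msg
  parent : Option ℕ
  mine : ℕ → Msg

namespace NodeState

variable (f : ℕ × ℕ → ℕ) (s : NodeState)

/-- Store the messages that have arrived. -/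
def absorb (inbox : Mailbox) : NodeState where
  view := s.view
  done := s.done
  got κ j := match inbox j with
    | some (k :: e :: m) => if (k, e) = κ then some m else s.got κ j
    | _ => s.got κ j
  parent := s.parent
  mine := s.mine

/-- The neighbour `j` has announced that this vertex is its parent. -/
def IsChild (j : ℕ) : Prop := s.got (false, false) j = some [true]

/-- All that is required before messages of kind `κ` can be sent has happened. -/
def Ready : Kind → Prop
  | (k, false) =>
    if s.view.isLeader then k = true → s.done (false, true) = true
    else ∃ j ∈ s.view.nbrs, s.got (k, false) j ≠ none
  | (k, true) => s.done (k, false) = true ∧ ∀ j ∈ s.view.nbrs,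
    s.got (k, false) j ≠ none ∧ (s.IsChild j → s.got (k, true) j ≠ none)

open Classical in
/-- The number of vertices and the sum of the degrees in the subtree. -/
def count : ℕ × ℕ :=
  (1, s.view.nbrs.card) + ∑ j ∈ s.view.nbrs,
    if s.IsChild j then decodePair ((s.got (false, true) j).getD []) else 0

/-- The number of bits of the labels, which the leader computes from the numbers of vertices and
edges, and which the other vertices read off from the labels they receive. -/
def numBits : ℕ :=
  if s.view.isLeader then f s.count
  else s.view.nbrs.sup fun j => ((s.got (true, false) j).getD []).length

open Classical in
/-- The label of the edge to the neighbour `j` if that is not the parent. -/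
def lowerLabel (j : ℕ) : Msg :=
  if s.IsChild j then (s.got (true, true) j).getD []
  else if s.view.id < j then s.mine j else (s.got (true, false) j).getD []

open Classical in
/-- The label of the edge to the parent. -/
def fold : Msg :=
  List.ofFn fun i : Fin (s.numBits f) =>
    ∑ j ∈ s.view.nbrs, if s.parent ≠ some j then (s.lowerLabel j).getD i false else 0

open Classical in
/-- The label of the edge to the neighbour `j`. -/
def edgeLabel (j : ℕ) : Msg := if s.parent = some j then s.fold f else s.lowerLabel j

open Classical in
/-- The payload of the message of kind `κ` to the neighbour `j`. -/
def payload (j : ℕ) : Kind → Msg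
  | (false, false) => [decide (s.parent = some j)]
  | (false, true) => encodePair s.count
  | (true, false) => s.mine j
  | (true, true) => s.fold f

open Classical in
/-- The state after storing the messages which have arrived, deciding what to send, choosing a
parent as soon as the first flood arrives, and choosing random labels as soon as the second flood
arrives. -/
def next (inbox : Mailbox) (coins : List Bool) : NodeState where
  view := s.view
  done κ := decide ((s.absorb inbox).Ready κ)
  got := (s.absorb inbox).got
  parent :=
    if (s.absorb inbox).Ready (false, false) ∧ s.done (false, false) = false then
      if s.view.isLeader then none
      else some (sInf {j | j ∈ s.view.nbrs ∧ (s.absorb inbox).got (false, false) j ≠ none})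
    else s.parent
  mine :=
    if (s.absorb inbox).Ready (true, false) ∧ s.done (true, false) = false then fun j =>
      List.ofFn fun i : Fin ((s.absorb inbox).numBits f) =>
        coins.getD (j * (s.absorb inbox).numBits f + i) false
    else s.mine

open Classical in
/-- The messages which are sent when the state changes from `s` to `s'`. -/
def outbox (s' : NodeState) : Mailbox := fun j =>
  ([(false, false), (false, true), (true, false), (true, true)].find? fun κ : Kind =>
    decide (s'.done κ = true ∧ s.done κ = false ∧ (κ.2 = true → s'.parent = some j))).map fun κ =>
      κ.1 :: κ.2 :: s'.payload f j κ

open Classical in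
/-- The final output. -/
def result : CutEdgeOutput where
  parent := s.parent
  inTree j := decide (s.parent = some j ∨ s.IsChild j)
  label := s.edgeLabel f
  isCut j := decide (∀ x ∈ s.edgeLabel f j, x = false)

end NodeState

open Classical in
/-- Two floods, each followed by an echo. The first phase builds the tree and counts the vertices
and edges, from which `f` determines the number of bits. The second phase samples a random
circulation. The output is passed through `r`. -/
def circulationAlgorithm {O : Type} (f : ℕ × ℕ → ℕ) (r : CutEdgeOutput → O) : Algorithm O where
  State := NodeState
  init w := ⟨w, fun _ => false, fun _ _ => none, none, fun _ => []⟩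
  -- A lone vertex must halt at once, because the time bound is a multiple of the diameter, which is
  -- zero.
  output s := if s.done (true, true) = true ∨ s.view.nbrs = ∅ then some (r (s.result f)) else none
  -- Bit `i` for the neighbour `j` uses coin `j * numBits + i`; this many coins cover all
  -- neighbours.
  coins s inbox := (s.view.nbrs.sup id + 1) * (s.absorb inbox).numBits f
  step s inbox coins := (s.next f inbox coins, s.outbox f (s.next f inbox coins))

/-! ### Correctness -/

section Correctness

open Classical

variable {V : Type} [Fintype V] (N : Network V) (ω : Coins V) (b : ℕ)

namespace Network

/-- The random label which `u` proposes for the edge to `v`. -/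
def ownLabel (u v : V) (i : Fin b) : Bool :=
  ω (u, N.sendTime (true, false) u - 1, N.ID v * b + i)

/-- The label of a non-tree edge: the one proposed by the end with the smaller identifier. -/
def chordLabel (u v : V) : Fin b → Bool :=
  if N.ID u < N.ID v then N.ownLabel ω b u v else N.ownLabel ω b v u

lemma chordLabel_comm (u v : V) : N.chordLabel ω b u v = N.chordLabel ω b v u := by
  unfold chordLabel
  rcases lt_trichotomy (N.ID u) (N.ID v) with h | h | h
  · rw [if_pos h, if_neg h.asymm]
  · rw [N.ID_injective h]
  · rw [if_neg h.asymm, if_pos h]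

/-- The payload of the message of kind `κ` from `u` to `v`. -/
def content (u v : V) : Kind → Msg
  | (false, false) => [decide (N.IsParent v u)]
  | (false, true) => encodePair (N.subtreeCount u)
  | (true, false) => List.ofFn (N.ownLabel ω b u v)
  | (true, true) => List.ofFn (N.flow (N.chordLabel ω b) u)

/-- The message which `u` sends to `v` in round `t`. -/
def message (t : ℕ) (u v : V) : Option Msg :=
  ([(false, false), (false, true), (true, false), (true, true)].find? fun κ : Kind =>
    decide (N.sendTime κ u = t ∧ N.IsRecipient κ u v)).map fun κ =>
      κ.1 :: κ.2 :: N.content ω b u v κ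

variable {N ω b}

lemma message_eq_some {t : ℕ} {u v : V} {κ : Kind} (h : N.sendTime κ u = t)
    (h' : N.IsRecipient κ u v) : N.message ω b t u v = some (κ.1 :: κ.2 :: N.content ω b u v κ) := by
  have h1 : ∀ κ' : Kind, (N.sendTime κ' u = t ∧ N.IsRecipient κ' u v) ↔ κ' = κ := by
    intro κ'
    exact ⟨fun h2 => sendTime_injective u (h2.1.trans h.symm), fun h2 => h2 ▸ ⟨h, h'⟩⟩
  unfold message
  simp only [h1]
  rcases κ with ⟨_ | _, _ | _⟩ <;> rfl

lemma message_cases (t : ℕ) (u v : V) : N.message ω b t u v = none ∨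
    ∃ κ, N.sendTime κ u = t ∧ N.IsRecipient κ u v ∧
      N.message ω b t u v = some (κ.1 :: κ.2 :: N.content ω b u v κ) := by
  by_cases h : ∃ κ, N.sendTime κ u = t ∧ N.IsRecipient κ u v
  · obtain ⟨κ, h1, h2⟩ := h
    exact Or.inr ⟨κ, h1, h2, message_eq_some h1 h2⟩
  · left
    push Not at h
    simp only [message, Option.map_eq_none_iff, List.find?_eq_none, decide_eq_true_eq]
    exact fun κ _ h' => h κ h'.1 h'.2

variable (N ω b)

/-- The state `s` of the vertex `v` contains its local view and the messages that have been sent to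
`v` before round `t`. -/
structure Received (t : ℕ) (v : V) (s : NodeState) : Prop where
  view : s.view = N.view v
  got : ∀ κ u, N.graph.Adj u v → s.got κ (N.ID u) =
    if N.IsRecipient κ u v ∧ N.sendTime κ u < t then some (N.content ω b u v κ) else none

/-- The state `s` of the vertex `v` is as it should be after round `t`. -/
structure Invariant (t : ℕ) (v : V) (s : NodeState) : Prop extends N.Received ω b t v s where
  done : ∀ κ, s.done κ = true ↔ N.sendTime κ v ≤ t
  parent : N.sendTime (false, false) v ≤ t →
    s.parent = if v = N.leader then none else some (N.ID (N.par v))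
  mine : N.sendTime (true, false) v ≤ t → ∀ u, N.graph.Adj v u →
    s.mine (N.ID u) = List.ofFn (N.ownLabel ω b v u)

variable {N ω b}

lemma Received.absorb {t : ℕ} {v : V} {s : NodeState} (h : N.Received ω b t v s) {inbox : Mailbox}
    (hin : ∀ u, N.graph.Adj u v → inbox (N.ID u) = N.message ω b t u v) :
    N.Received ω b (t + 1) v (s.absorb inbox) where
  view := h.view
  got κ u hu := by
    have h0 := h.got κ u hu
    simp only [NodeState.absorb, hin u hu]
    by_cases h1 : N.sendTime κ u = t ∧ N.IsRecipient κ u v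
    · rw [message_eq_some h1.1 h1.2]
      simp only [Prod.mk.eta, if_true]
      rw [if_pos ⟨h1.2, by omega⟩]
    · have h2 : (N.IsRecipient κ u v ∧ N.sendTime κ u < t + 1) ↔
          (N.IsRecipient κ u v ∧ N.sendTime κ u < t) := by
        refine and_congr_right fun h3 => ?_
        have : N.sendTime κ u ≠ t := fun h4 => h1 ⟨h4, h3⟩
        omega
      simp only [h2]
      rcases message_cases (N := N) (ω := ω) (b := b) t u v with h3 | ⟨κ', h3, h4, h5⟩
      · rw [h3]
        exact h0
      · rw [h5]
        have h6 : (κ'.1, κ'.2) ≠ κ := by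
          rintro rfl
          exact h1 ⟨h3, h4⟩
        simp only [if_neg h6]
        exact h0

section Received

variable {t : ℕ} {v : V} {s : NodeState} (h : N.Received ω b t v s)
include h

lemma Received.got_flood_ne_none {k : Bool} {u : V} (hu : N.graph.Adj u v) :
    s.got (k, false) (N.ID u) ≠ none ↔ N.sendTime (k, false) u < t := by
  rw [h.got _ u hu]
  simp [IsRecipient]

lemma Received.got_echo_ne_none {k : Bool} {u : V} (hu : N.IsParent v u) :
    s.got (k, true) (N.ID u) ≠ none ↔ N.sendTime (k, true) u < t := by
  rw [h.got _ u hu.1.symm]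
  simp [IsRecipient, hu]

lemma Received.isChild_iff {u : V} (hu : N.graph.Adj u v) :
    s.IsChild (N.ID u) ↔ N.IsParent v u ∧ N.sendTime (false, false) u < t := by
  rw [NodeState.IsChild, h.got _ u hu]
  simp [IsRecipient, content, and_comm]

/-- The echo of `v` comes after those of its children, hence after their floods, which announced `v`
as parent. -/
lemma Received.isChild_iff_of_done (ht : N.sendTime (false, true) v ≤ t) {u : V}
    (hu : N.graph.Adj u v) : s.IsChild (N.ID u) ↔ N.IsParent v u := by
  rw [h.isChild_iff hu, and_iff_left_iff_imp]
  intro h1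
  have h2 := h1.echoTime_lt (base := N.startTime false)
  have h3 := N.sendTime_flood_lt_echo false u
  simp only [sendTime_echo] at *
  omega

lemma Received.isLeader : s.view.isLeader = true ↔ v = N.leader := by
  rw [h.view, Network.view, decide_eq_true_eq]

lemma Received.count (ht : N.sendTime (false, true) v ≤ t) : s.count = N.subtreeCount v := by
  rw [NodeState.count, subtreeCount_eq, h.view, sum_nbrs]
  congr 1
  refine Finset.sum_congr rfl fun u _ => ?_
  by_cases hu : N.graph.Adj v u
  · rw [if_pos hu]
    simp only [h.isChild_iff_of_done ht hu.symm]
    by_cases hp : N.IsParent v u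
    · rw [if_pos hp, if_pos hp, h.got _ u hu.symm, if_pos, Option.getD_some, content,
        decodePair_encodePair]
      exact ⟨fun _ => hp, hp.echoTime_lt.trans_le ht⟩
    · rw [if_neg hp, if_neg hp]
  · rw [if_neg hu, if_neg fun hp => hu hp.1]

/-- The leader has its complete count. Any other vertex takes the maximal length of the labels
received: each has length `b`, a missing one counts as zero, and the parent's has arrived. -/
lemma Received.numBits {f : ℕ × ℕ → ℕ} (hf : f (N.subtreeCount N.leader) = b)
    (ht : N.sendTime (true, false) v ≤ t) : s.numBits f = b := by
  unfold NodeState.numBits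
  by_cases hv : v = N.leader
  · rw [if_pos (h.isLeader.mpr hv), h.count ((sendTime_echo_lt_flood v).le.trans ht), hv, hf]
  · rw [if_neg fun h' => hv (h.isLeader.mp h')]
    refine le_antisymm (Finset.sup_le fun j hj => ?_) ?_
    · rw [h.view] at hj
      obtain ⟨u, rfl, hu⟩ := N.exists_of_mem_nbrs hj
      rw [h.got _ u hu.symm]
      split_ifs <;> simp [content]
    · have hp := isParent_par hv
      have h1 := Finset.le_sup (f := fun j => ((s.got (true, false) j).getD []).length)
        (h.view ▸ N.mem_nbrs.mpr hp.1.symm)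
      refine le_trans (le_of_eq ?_) h1
      have h2 : N.sendTime (true, false) (N.par v) < t := by
        have := hp.2.1
        rw [sendTime_flood] at *
        omega
      simp only [h.got _ _ hp.1, IsRecipient, h2]
      simp [content]

end Received

section Invariant

variable {t : ℕ} {v : V} {s : NodeState} (h : N.Invariant ω b t v s)
include h

lemma Invariant.parent_eq_some (ht : N.sendTime (false, false) v ≤ t) {u : V} :
    s.parent = some (N.ID u) ↔ N.IsParent u v := by
  rw [h.parent ht, isParent_iff]
  split_ifs with hv
  · simp [hv]
  · simp [hv, N.ID_injective.eq_iff]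

lemma Invariant.lowerLabel (ht : N.sendTime (true, true) v ≤ t) {u : V} (hu : N.graph.Adj v u) :
    s.lowerLabel (N.ID u) = List.ofFn
      (if N.IsParent v u then N.flow (N.chordLabel ω b) u else N.chordLabel ω b v u) := by
  obtain ⟨t, rfl⟩ : ∃ t', t = t' + 1 :=
    ⟨t - 1, by have := N.sendTime_pos (true, true) v; omega⟩
  have h1 := sendTime_echo_le_iff.mp ht
  unfold NodeState.lowerLabel
  simp only [h.isChild_iff_of_done ((sendTime_le_last _ v).trans ht) hu.symm]
  by_cases hp : N.IsParent v u
  · rw [if_pos hp, if_pos hp, h.got _ u hu.symm,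
      if_pos ⟨fun _ => hp, Nat.lt_succ_of_le (h1.2.2 u hp)⟩]
    rfl
  · rw [if_neg hp, if_neg hp, h.view]
    unfold chordLabel
    change (if N.ID v < N.ID u then _ else _) = _
    split_ifs
    · exact h.mine ((sendTime_le_last _ v).trans ht) u hu
    · rw [h.got _ u hu.symm, if_pos ⟨fun h' => absurd h' (by simp),
        Nat.lt_succ_of_le (h1.2.1 u hu.symm)⟩]
      rfl

lemma Invariant.fold {f : ℕ × ℕ → ℕ} (hf : f (N.subtreeCount N.leader) = b)
    (ht : N.sendTime (true, true) v ≤ t) :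
    s.fold f = List.ofFn (N.flow (N.chordLabel ω b) v) := by
  have h1 := h.numBits hf ((sendTime_le_last _ v).trans ht)
  unfold NodeState.fold
  rw [h1]
  congr 1
  funext i
  rw [flow_eq, Finset.sum_apply, h.view, sum_nbrs]
  refine Finset.sum_congr rfl fun u _ => ?_
  by_cases hu : N.graph.Adj v u
  · rw [if_pos hu]
    simp only [ne_eq, h.parent_eq_some ((sendTime_le_last _ v).trans ht), hu, true_and]
    split_ifs with h2
    · rfl
    all_goals
      rw [h.lowerLabel ht hu]
      simp [*]
  · rw [if_neg hu, if_neg fun h' => hu h'.1]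
    rfl

lemma Invariant.edgeLabel {f : ℕ × ℕ → ℕ} (hf : f (N.subtreeCount N.leader) = b)
    (ht : N.sendTime (true, true) v ≤ t) {u : V} (hu : N.graph.Adj v u) :
    s.edgeLabel f (N.ID u) = List.ofFn (N.completion (N.chordLabel ω b) v u) := by
  unfold NodeState.edgeLabel completion
  simp only [h.parent_eq_some ((sendTime_le_last _ v).trans ht)]
  by_cases hp : N.IsParent u v
  · rw [if_pos hp, if_neg hp.not_symm, if_pos hp, h.fold hf ht]
  · rw [if_neg hp, h.lowerLabel ht hu, if_neg hp]

lemma Invariant.payload {f : ℕ × ℕ → ℕ} (hf : f (N.subtreeCount N.leader) = b) {κ : Kind}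
    (ht : N.sendTime κ v ≤ t) {u : V} (hu : N.graph.Adj v u) :
    s.payload f (N.ID u) κ = N.content ω b v u κ := by
  rcases κ with ⟨_ | _, _ | _⟩
  · simp only [NodeState.payload, content, h.parent_eq_some ht]
  · simp only [NodeState.payload, content, h.count ht]
  · exact h.mine ht u hu
  · exact h.fold hf ht

end Invariant

end Network
end Correctness

/-! ### Executions follow the schedule -/

section Correctness

open Classical

variable {V : Type} [Fintype V] {N : Network V} {ω : Coins V} {b : ℕ}

namespace Network

/-- Depths of adjacent vertices differ by at most one, so the earliest flood reaches `v` from a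
neighbour one level closer to the leader. For echoes, both sides satisfy the recursion
`sendTime_echo_le_iff`. -/
lemma Received.ready_iff {t : ℕ} {v : V} {s : NodeState} (h : N.Received ω b (t + 1) v s)
    (hd : ∀ κ, s.done κ = true ↔ N.sendTime κ v ≤ t) (κ : Kind) :
    s.Ready κ ↔ N.sendTime κ v ≤ t + 1 := by
  rcases κ with ⟨k, _ | _⟩
  · rw [NodeState.Ready]
    by_cases hv : v = N.leader
    · rw [if_pos (h.isLeader.mpr hv), hd, hv, sendTime_flood, N.depth_leader]
      cases k with
      | false => simp [startTime]
      | true => simp [startTime, sendTime]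
    · rw [if_neg fun h' => hv (h.isLeader.mp h'), h.view]
      constructor
      · rintro ⟨j, hj, h1⟩
        obtain ⟨u, rfl, hu⟩ := N.exists_of_mem_nbrs hj
        rw [h.got_flood_ne_none hu.symm] at h1
        have := N.depth_le_of_adj hu.symm
        rw [sendTime_flood] at *
        omega
      · intro h1
        have hp := isParent_par hv
        refine ⟨_, N.mem_nbrs.mpr hp.1.symm, (h.got_flood_ne_none hp.1).mpr ?_⟩
        have := hp.2.1
        rw [sendTime_flood] at *
        omega
  · rw [NodeState.Ready, hd, sendTime_echo_le_iff, h.view]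
    refine and_congr_right fun _ => ?_
    constructor
    · intro h1
      have h2 : ∀ u, N.graph.Adj u v → N.sendTime (k, false) u ≤ t := fun u hu =>
        Nat.le_of_lt_succ ((h.got_flood_ne_none hu).mp (h1 _ (N.mem_nbrs.mpr hu.symm)).1)
      refine ⟨h2, fun u hu => Nat.le_of_lt_succ ((h.got_echo_ne_none hu).mp
        ((h1 _ (N.mem_nbrs.mpr hu.1)).2 ((h.isChild_iff hu.1.symm).mpr ⟨hu, ?_⟩)))⟩
      have h3 := h2 u hu.1.symm
      -- Children are recognized by their first-phase flood, even when `k` refers to the second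
      -- phase.
      have h4 : N.sendTime (false, false) u ≤ N.sendTime (k, false) u := by
        cases k with
        | false => exact le_rfl
        | true => exact ((N.sendTime_flood_lt_echo false u).trans (N.sendTime_echo_lt_flood u)).le
      omega
    · intro h1 j hj
      obtain ⟨u, rfl, hu⟩ := N.exists_of_mem_nbrs hj
      refine ⟨(h.got_flood_ne_none hu.symm).mpr (Nat.lt_succ_of_le (h1.1 u hu.symm)), fun h2 => ?_⟩
      have h3 := ((h.isChild_iff hu.symm).mp h2).1
      exact (h.got_echo_ne_none h3).mpr (Nat.lt_succ_of_le (h1.2 u h3))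

/-- When `v` is about to send its first flood, only neighbours one level closer to the leader have
been heard, and the parent is the smallest of these. -/
lemma Received.sInf_senders {v : V} {s : NodeState} (hv : v ≠ N.leader)
    (h : N.Received ω b (N.sendTime (false, false) v) v s) :
    sInf {j | j ∈ s.view.nbrs ∧ s.got (false, false) j ≠ none} = N.ID (N.par v) := by
  have hp := isParent_par hv
  rw [h.view]
  have h1 : N.ID (N.par v) ∈
      {j | j ∈ (N.view v).nbrs ∧ s.got (false, false) j ≠ none} := by
    refine ⟨N.mem_nbrs.mpr hp.1.symm, (h.got_flood_ne_none hp.1).mpr ?_⟩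
    have := hp.2.1
    rw [sendTime_flood, sendTime_flood]
    omega
  refine le_antisymm (Nat.sInf_le h1) (le_csInf ⟨_, h1⟩ ?_)
  rintro j ⟨hj, h2⟩
  obtain ⟨u, rfl, hu⟩ := N.exists_of_mem_nbrs hj
  rw [h.got_flood_ne_none hu.symm, sendTime_flood, sendTime_flood] at h2
  have := N.depth_le_of_adj hu.symm
  exact hp.2.2 u hu.symm (by omega)

section Step

variable {t : ℕ} {v : V} {s : NodeState} (h : N.Invariant ω b t v s) {inbox : Mailbox}
  (hin : ∀ u, N.graph.Adj u v → inbox (N.ID u) = N.message ω b t u v)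
include h hin

lemma Invariant.ready_absorb_iff (κ : Kind) :
    (s.absorb inbox).Ready κ ↔ N.sendTime κ v ≤ t + 1 :=
  (h.toReceived.absorb hin).ready_iff h.done κ

lemma Invariant.fresh_iff (κ : Kind) :
    ((s.absorb inbox).Ready κ ∧ s.done κ = false) ↔ N.sendTime κ v = t + 1 := by
  rw [h.ready_absorb_iff hin, Bool.eq_false_iff, ne_eq, h.done]
  omega

lemma Invariant.next {f : ℕ × ℕ → ℕ} (hf : f (N.subtreeCount N.leader) = b) {coins : List Bool}
    (hcoins : coins = List.ofFn
      fun i : Fin ((s.view.nbrs.sup id + 1) * (s.absorb inbox).numBits f) => ω (v, t, i.val)) :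
    N.Invariant ω b (t + 1) v (s.next f inbox coins) := by
  have hr := h.toReceived.absorb hin
  refine ⟨⟨hr.view, hr.got⟩, fun κ => ?_, fun ht => ?_, fun ht u hu => ?_⟩
  · simp only [NodeState.next, decide_eq_true_eq]
    exact h.ready_absorb_iff hin κ
  · simp only [NodeState.next, h.fresh_iff hin, h.isLeader]
    split_ifs with h1 h2 h2
    · rfl
    · exact congrArg some (Received.sInf_senders h2 (h1 ▸ hr))
    · rw [h.parent (by omega), if_pos h2]
    · rw [h.parent (by omega), if_neg h2]
  · simp only [NodeState.next, h.fresh_iff hin]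
    split_ifs with h1
    · have hb := hr.numBits hf ht
      subst hcoins
      rw [hb]
      dsimp only
      congr 1
      funext i
      have h2 : N.ID u ≤ s.view.nbrs.sup id :=
        Finset.le_sup (f := id) (h.view ▸ N.mem_nbrs.mpr hu)
      have h3 : N.ID u * b + i < (s.view.nbrs.sup id + 1) * b := by
        have := Nat.mul_le_mul_right b h2
        have := i.2
        rw [Nat.add_mul]
        omega
      rw [List.getD_eq_getElem _ _ (by simpa using h3), List.getElem_ofFn, ownLabel, h1]
      simp
    · exact h.mine (by omega) u hu

omit hin in
lemma Invariant.outbox {f : ℕ × ℕ → ℕ} (hf : f (N.subtreeCount N.leader) = b) {s' : NodeState}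
    (h' : N.Invariant ω b (t + 1) v s') {u : V} (hu : N.graph.Adj v u) :
    s.outbox f s' (N.ID u) = N.message ω b (t + 1) v u := by
  have h1 : ∀ κ : Kind, (s'.done κ = true ∧ s.done κ = false ∧
      (κ.2 = true → s'.parent = some (N.ID u))) ↔
      (N.sendTime κ v = t + 1 ∧ N.IsRecipient κ v u) := by
    intro κ
    rw [Bool.eq_false_iff, ne_eq, h.done, h'.done, ← and_assoc]
    have h2 : (N.sendTime κ v ≤ t + 1 ∧ ¬ N.sendTime κ v ≤ t) ↔ N.sendTime κ v = t + 1 := by omega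
    rw [h2]
    refine and_congr_right fun h3 => imp_congr_right fun hκ => h'.parent_eq_some ?_
    rcases κ with ⟨k, e⟩
    dsimp only at hκ
    subst hκ
    have h4 := N.sendTime_flood_lt_echo k v
    cases k with
    | false => omega
    | true =>
      have := N.sendTime_flood_lt_echo false v
      have := N.sendTime_echo_lt_flood v
      omega
  unfold NodeState.outbox message
  simp only [h1]
  refine Option.map_congr fun κ hκ => ?_
  have h2 := List.find?_some hκ
  rw [decide_eq_true_eq] at h2
  rw [h'.payload hf h2.1.le hu]

end Step

variable (N)

lemma nbrs_eq_empty_iff {v : V} : (N.view v).nbrs = ∅ ↔ Subsingleton V := by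
  constructor
  · intro h
    by_contra hV
    rw [not_subsingleton_iff_nontrivial] at hV
    obtain ⟨u, hu⟩ := N.connected.preconnected.exists_adj_of_nontrivial v
    have := N.mem_nbrs.mpr hu
    rw [h] at this
    exact absurd this (Finset.notMem_empty _)
  · intro hV
    refine Finset.eq_empty_of_forall_notMem fun j hj => ?_
    obtain ⟨u, -, hu⟩ := N.exists_of_mem_nbrs hj
    exact hu.ne (Subsingleton.elim _ _)

end Network

variable (N)

omit [Fintype V] in
lemma deliver_apply {u v : V} (h : N.graph.Adj u v) (out : V → Mailbox) :
    Algorithm.deliver N out v (N.ID u) = out u (N.ID v) := by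
  rw [Algorithm.deliver, N.ID_injective.extend_apply, if_pos h]

variable {O : Type} (f : ℕ × ℕ → ℕ) (r : CutEdgeOutput → O)

lemma output_isSome_iff (s : NodeState) : ((circulationAlgorithm f r).output s).isSome = true ↔
    s.done (true, true) = true ∨ s.view.nbrs = ∅ := by
  simp only [circulationAlgorithm]
  split_ifs with h <;> simp [h]

/-- The minimum reflects that `v` halts upon sending its last echo: its state is frozen from then
on, and nothing is scheduled later. -/
lemma config_spec [Nontrivial V] (hf : f (N.subtreeCount N.leader) = b) (t : ℕ) (v : V) :
    N.Invariant ω b (min t (N.sendTime (true, true) v)) v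
        ((circulationAlgorithm f r).config N ω t v).1 ∧
      ∀ u, N.graph.Adj v u →
        ((circulationAlgorithm f r).config N ω t v).2 (N.ID u) = N.message ω b t v u := by
  induction t generalizing v with
  | zero =>
    constructor
    · rw [Nat.zero_min]
      refine ⟨⟨rfl, fun κ u _ => ?_⟩, fun κ => ?_, fun ht => ?_, fun ht => ?_⟩
      · rw [if_neg (by omega)]
        rfl
      · have := N.sendTime_pos κ v
        exact ⟨fun h => absurd h Bool.false_ne_true, fun h => by omega⟩
      · have := N.sendTime_pos (false, false) v
        omega
      · have := N.sendTime_pos (true, false) v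
        omega
    · intro u hu
      rcases N.message_cases (ω := ω) (b := b) 0 v u with h | ⟨κ, h, -⟩
      · rw [h]
        rfl
      · have := N.sendTime_pos κ v
        omega
  | succ t ih =>
    have h := (ih v).1
    have hin : ∀ u, N.graph.Adj u v →
        Algorithm.deliver N (fun u => ((circulationAlgorithm f r).config N ω t u).2) v (N.ID u) =
          N.message ω b t u v := by
      intro u hu
      rw [deliver_apply N hu]
      exact (ih u).2 v hu
    rw [Algorithm.config]
    have hhalt : ((circulationAlgorithm f r).output
        ((circulationAlgorithm f r).config N ω t v).1).isSome = true ↔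
        N.sendTime (true, true) v ≤ t := by
      refine (output_isSome_iff f r _).trans ?_
      rw [h.done, h.view, N.nbrs_eq_empty_iff,
        or_iff_left (not_subsingleton V)]
      omega
    dsimp only
    by_cases ht : N.sendTime (true, true) v ≤ t
    · rw [if_pos (hhalt.mpr ht)]
      rw [min_eq_right ht] at h
      refine ⟨by rwa [min_eq_right (by omega)], fun u hu => ?_⟩
      rcases N.message_cases (ω := ω) (b := b) (t + 1) v u with h1 | ⟨κ, h1, -⟩
      · rw [h1]
      · have := N.sendTime_le_last κ v
        omega
    · rw [if_neg fun h' => ht (hhalt.mp h')]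
      rw [min_eq_left (by omega)] at h
      rw [min_eq_left (by omega)]
      have h1 := h.next hin hf rfl
      exact ⟨h1, fun u hu => h.outbox hf h1 hu⟩

end Correctness

/-! ### Halting is permanent -/

section Halting

variable {O : Type} (A : Algorithm O) {V : Type} [Fintype V] (N : Network V) (ω : Coins V)

lemma output_config_of_le {t t' : ℕ} (h : t ≤ t') {v : V} {o : O}
    (ho : A.output (A.config N ω t v).1 = some o) : A.output (A.config N ω t' v).1 = some o := by
  induction t', h using Nat.le_induction with
  | base => exact ho
  | succ t' _ ih =>
    rw [Algorithm.config]
    simp only [ih, Option.isSome_some, if_true]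

variable {A N ω}

lemma haltsWith_unique {out out' : V → O} (h : A.HaltsWith N ω out) (h' : A.HaltsWith N ω out') :
    out = out' := by
  obtain ⟨t, ht⟩ := h
  obtain ⟨t', ht'⟩ := h'
  funext v
  have h1 := output_config_of_le A N ω (le_max_left t t') (ht v)
  have h2 := output_config_of_le A N ω (le_max_right t t') (ht' v)
  exact Option.some_injective _ (h1.symm.trans h2)

end Halting

/-! ### Meaning of the outputs -/

section Correctness

open Classical

variable {V : Type} [Fintype V] {N : Network V} {ω : Coins V} {b : ℕ}

lemma forall_mem_ofFn_eq_false {x : Fin b → Bool} :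
    (∀ c ∈ List.ofFn x, c = false) ↔ x = 0 := by
  rw [List.forall_mem_ofFn_iff, funext_iff]
  rfl

variable {O : Type} (f : ℕ × ℕ → ℕ) (r : CutEdgeOutput → O)

lemma config_of_subsingleton [Subsingleton V] (t : ℕ) (v : V) :
    (circulationAlgorithm f r).config N ω t v =
      ((circulationAlgorithm f r).init (N.view v), fun _ => none) := by
  have h : ((circulationAlgorithm f r).output
      ((circulationAlgorithm f r).init (N.view v))).isSome = true :=
    (output_isSome_iff f r _).mpr (Or.inr (N.nbrs_eq_empty_iff.mpr ‹_›))
  induction t with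
  | zero => rfl
  | succ t ih =>
    rw [Algorithm.config]
    simp only [ih, h, if_true]

variable (N ω)

/-- The output of every vertex: the tree is the breadth-first search tree, and the labels are the
completion of the random labels of the non-tree edges. -/
structure OutputSpec (b : ℕ) (out : V → CutEdgeOutput) : Prop where
  parent : ∀ v p, (out v).parent = some p ↔ ∃ u, N.ID u = p ∧ N.IsParent u v
  inTree : ∀ u v, N.graph.Adj u v → ((out u).inTree (N.ID v) = true ↔ N.bfsTree.Adj u v)
  label : ∀ u v, N.graph.Adj u v →
    (out u).label (N.ID v) = List.ofFn (N.completion (N.chordLabel ω b) u v)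
  isCut : ∀ u v, N.graph.Adj u v →
    ((out u).isCut (N.ID v) = true ↔ N.completion (N.chordLabel ω b) u v = 0)

lemma output_eq_some {s : NodeState} (h : s.done (true, true) = true ∨ s.view.nbrs = ∅) :
    (circulationAlgorithm f r).output s = some (r (s.result f)) := if_pos h

lemma exists_outputSpec (hf : f (N.subtreeCount N.leader) = b) :
    ∃ out : V → CutEdgeOutput, OutputSpec N ω b out ∧
      (circulationAlgorithm f r).HaltsWith N ω fun v => r (out v) := by
  rcases subsingleton_or_nontrivial V with hV | hV
  · have hadj : ∀ u v, ¬ N.graph.Adj u v := fun u v h => h.ne (Subsingleton.elim _ _)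
    let s : V → NodeState := fun v => ⟨N.view v, fun _ => false, fun _ _ => none, none, fun _ => []⟩
    refine ⟨fun v => (s v).result f, ⟨fun v p => ?_, fun u v h => absurd h (hadj u v),
      fun u v h => absurd h (hadj u v), fun u v h => absurd h (hadj u v)⟩, 0, fun v => ?_⟩
    · constructor
      · intro h
        exact absurd h (by simp [NodeState.result, s])
      · rintro ⟨u, -, h⟩
        exact absurd h.1 (hadj u v)
    · exact output_eq_some f r (Or.inr (N.nbrs_eq_empty_iff.mpr hV))
  · let T := 6 + 4 * N.graph.diam
    have hinv : ∀ v, N.Invariant ω b (N.sendTime (true, true) v) v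
        ((circulationAlgorithm f r).config N ω T v).1 := by
      intro v
      have := (config_spec N f r (ω := ω) hf T v).1
      rwa [min_eq_right (N.sendTime_le _ v)] at this
    refine ⟨fun v => NodeState.result f ((circulationAlgorithm f r).config N ω T v).1,
      ⟨fun v p => ?_, fun u v h => ?_, fun u v h => (hinv u).edgeLabel hf le_rfl h,
        fun u v h => ?_⟩, T, fun v => ?_⟩
    · have h1 := fun u => (hinv v).parent_eq_some (u := u) (N.sendTime_le_last _ v)
      have h2 := (hinv v).parent (N.sendTime_le_last _ v)
      constructor
      · intro h
        simp only [NodeState.result] at h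
        rw [h] at h2
        split_ifs at h2
        rw [Option.some_inj] at h2
        exact ⟨_, h2.symm, (h1 _).mp (h.trans (congrArg some h2))⟩
      · rintro ⟨u, rfl, h⟩
        exact (h1 u).mpr h
    · simp only [NodeState.result, decide_eq_true_eq]
      rw [(hinv u).parent_eq_some (N.sendTime_le_last _ u),
        (hinv u).isChild_iff_of_done (N.sendTime_le_last _ u) h.symm]
      exact or_comm
    · simp only [NodeState.result, decide_eq_true_eq]
      rw [(hinv u).edgeLabel hf le_rfl h, forall_mem_ofFn_eq_false]
    · exact output_eq_some f r (Or.inl (((hinv v).done _).mpr le_rfl))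

variable {N ω}

lemma OutputSpec.describesBFSTree {out : V → CutEdgeOutput} (h : OutputSpec N ω b out) :
    DescribesBFSTree N fun v => (out v).toTreeAndLabels := by
  refine ⟨N.bfsTree, N.isBFSTree_bfsTree, h.inTree, fun v p => (h.parent v p).trans ?_⟩
  refine exists_congr fun u => and_congr_right fun _ => ?_
  rw [N.bfsTree_dist, N.bfsTree_dist]
  constructor
  · exact fun h1 => ⟨Or.inl h1, h1.2.1⟩
  · rintro ⟨h1 | h1, h2⟩
    · exact h1
    · have := h1.2.1
      omega

lemma OutputSpec.describesLabelling {out : V → CutEdgeOutput} (h : OutputSpec N ω b out) :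
    DescribesLabelling N (fun v => (out v).toTreeAndLabels)
      (N.completionLabel (N.chordLabel_comm ω b)) := h.label

/-- The error is one-sided: cut edges always have label zero, so only non-cut edges need a
hypothesis. -/
lemma OutputSpec.describesCutEdges {out : V → CutEdgeOutput} (h : OutputSpec N ω b out)
    (h' : ∀ e : N.graph.edgeSet, ¬ IsCutEdge N.graph e.1 →
      N.completionLabel (N.chordLabel_comm ω b) e ≠ 0) : DescribesCutEdges N out := by
  intro u v huv
  rw [h.isCut u v huv]
  constructor
  · intro h1
    by_contra h2
    exact h' ⟨s(u, v), huv⟩ h2 h1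
  · intro h1
    funext i
    exact (N.isBitCirculation_completionLabel (N.chordLabel_comm ω b)).eq_zero_of_isCutEdge
      N.connected huv h1 i

/-! ### Time, messages and bits -/

variable (N)

lemma buildsBFSTree (hf : f (N.subtreeCount N.leader) = b) {tl : O → TreeAndLabels}
    (htl : ∀ x, tl (r x) = x.toTreeAndLabels) :
    BuildsBFSTree N (circulationAlgorithm f r) tl := by
  intro ω
  obtain ⟨out, h1, h2⟩ := exists_outputSpec N ω f r hf
  refine ⟨_, h2, ?_⟩
  simp only [htl]
  exact h1.describesBFSTree

lemma length_content_le {c : ℕ} (hb : b ≤ c * (Fintype.card V).size) (u v : V) (κ : Kind) :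
    (N.content ω b u v κ).length ≤ (4 + c) * (Fintype.card V).size := by
  have hpos : 0 < Fintype.card V := Fintype.card_pos_iff.mpr ⟨u⟩
  have h1 : 1 ≤ (Fintype.card V).size := Nat.size_pos.mpr hpos
  rw [Nat.add_mul]
  rcases κ with ⟨_ | _, _ | _⟩
  · simp only [Network.content, List.length_singleton]
    omega
  · simp only [Network.content, encodePair, Nat.size_eq_bits_len]
    refine le_trans (Nat.size_le.mpr ?_) (Nat.le_add_right _ _)
    have h2 := N.subtreeCount_le u
    have h3 : 2 * N.numEdges ≤ Fintype.card V * (Fintype.card V - 1) := by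
      rw [← N.sum_card_nbrs, ← smul_eq_mul]
      refine Finset.sum_le_card_nsmul _ _ _ fun v _ => ?_
      have : ((N.view v).nbrs).card ≤ (Finset.univ.erase v).card := by
        refine Finset.card_image_le.trans (Finset.card_le_card fun w hw => ?_)
        exact Finset.mem_erase.mpr ⟨(Finset.mem_filter.mp hw).2.ne', Finset.mem_univ _⟩
      simpa using this
    obtain ⟨n, hn⟩ : ∃ n, Fintype.card V = n + 1 := ⟨_, (Nat.succ_pred hpos.ne').symm⟩
    have h4 : Fintype.card V < 2 ^ (Fintype.card V).size := Nat.lt_size_self _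
    -- Both counts are below `(|V| + 1) ^ 2`, and pairing squares once more; this is the origin of
    -- the exponent `4`.
    have h5 : max (N.subtreeCount u).1 (N.subtreeCount u).2 + 1 ≤ (Fintype.card V + 1) ^ 2 := by
      refine Nat.succ_le_of_lt (max_lt (lt_of_le_of_lt h2.1 ?_) (lt_of_le_of_lt h2.2 ?_))
      · dsimp only
        nlinarith
      · refine lt_of_le_of_lt h3 ?_
        rw [hn]
        simp only [Nat.add_sub_cancel]
        nlinarith
    calc Nat.pair (N.subtreeCount u).1 (N.subtreeCount u).2
        < (max (N.subtreeCount u).1 (N.subtreeCount u).2 + 1) ^ 2 := Nat.pair_lt_max_add_one_sq _ _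
      _ ≤ ((Fintype.card V + 1) ^ 2) ^ 2 := Nat.pow_le_pow_left h5 2
      _ ≤ ((2 ^ (Fintype.card V).size) ^ 2) ^ 2 :=
        Nat.pow_le_pow_left (Nat.pow_le_pow_left h4 2) 2
      _ = 2 ^ (4 * (Fintype.card V).size) := by rw [← pow_mul, ← pow_mul]; ring_nf
  · simp only [Network.content, List.length_ofFn]
    omega
  · simp only [Network.content, List.length_ofFn]
    omega

/-- The bit bound exceeds that for the contents by `2`, for the two bits that encode the kind. -/
lemma runsWithin {c : ℕ} (hf : f (N.subtreeCount N.leader) = b)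
    (hb : b ≤ c * (Fintype.card V).size) : (circulationAlgorithm f r).RunsWithin N
      (10 * N.graph.diam) (8 * N.numEdges) ((6 + c) * (Fintype.card V).size) := by
  rcases subsingleton_or_nontrivial V with hV | hV
  · have hsent : ∀ ω t u v, (circulationAlgorithm f r).sent N ω t u v = none := by
      intro ω t u v
      rw [Algorithm.sent, if_neg fun h => h.ne (Subsingleton.elim _ _)]
    refine ⟨fun ω v => ?_, fun ω t => ?_, fun ω t u v m hm => ?_⟩
    · rw [config_of_subsingleton]
      exact (output_isSome_iff f r _).mpr (Or.inr (N.nbrs_eq_empty_iff.mpr hV))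
    · simp [Algorithm.messages, hsent]
    · rw [hsent] at hm
      exact absurd hm (by simp)
  · have hsent : ∀ ω t u v, (circulationAlgorithm f r).sent N ω t u v =
        if N.graph.Adj u v then N.message ω b t u v else none := by
      intro ω t u v
      rw [Algorithm.sent]
      split_ifs with h
      · exact (config_spec N f r hf t u).2 v h
      · rfl
    refine ⟨fun ω v => ?_, fun ω t => ?_, fun ω t u v m hm => ?_⟩
    · have h1 : 6 + 4 * N.graph.diam ≤ 10 * N.graph.diam := by
        have := SimpleGraph.diam_ne_zero_of_ediam_ne_top
          (SimpleGraph.connected_iff_ediam_ne_top.mp N.connected)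
        omega
      have h2 := (config_spec N f r (ω := ω) hf (10 * N.graph.diam) v).1
      rw [min_eq_right ((N.sendTime_le _ v).trans h1)] at h2
      exact (output_isSome_iff f r _).mpr (Or.inl ((h2.done _).mpr le_rfl))
    · rw [Algorithm.messages, Finset.sum_comm]
      have h1 : ∀ u v, ∑ i ∈ Finset.range (t + 1),
          (if ((circulationAlgorithm f r).sent N ω i u v).isSome then 1 else 0) ≤
            if N.graph.Adj u v then 4 else 0 := by
        intro u v
        simp only [hsent]
        by_cases h : N.graph.Adj u v
        · simp only [if_pos h]
          rw [← Finset.card_filter]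
          -- Each of the four kinds occupies a single round.
          have h2 : (Finset.range (t + 1)).filter (fun i => (N.message ω b i u v).isSome) ⊆
              Finset.univ.image fun κ => N.sendTime κ u := by
            intro i hi
            rcases N.message_cases (ω := ω) (b := b) i u v with h3 | ⟨κ, h3, -⟩
            · simp [h3] at hi
            · exact Finset.mem_image.mpr ⟨κ, Finset.mem_univ _, h3⟩
          exact (Finset.card_le_card h2).trans Finset.card_image_le
        · simp [if_neg h]
      calc ∑ u, ∑ i ∈ Finset.range (t + 1), ∑ v,
            (if ((circulationAlgorithm f r).sent N ω i u v).isSome then 1 else 0)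
          ≤ ∑ u, ∑ v, if N.graph.Adj u v then 4 else 0 := by
            refine Finset.sum_le_sum fun u _ => ?_
            rw [Finset.sum_comm]
            exact Finset.sum_le_sum fun v _ => h1 u v
        _ = 8 * N.numEdges := by
            simp only [← N.sum_nbrs _ fun _ => 4, Finset.sum_const, smul_eq_mul]
            rw [← Finset.sum_mul, N.sum_card_nbrs]
            ring
    · rw [hsent] at hm
      split_ifs at hm with h
      rcases N.message_cases (ω := ω) (b := b) t u v with h1 | ⟨κ, -, -, h1⟩
      · rw [h1] at hm
        exact absurd hm (by simp)
      · rw [h1, Option.some_inj] at hm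
        rw [← hm, List.length_cons, List.length_cons]
        have h2 := length_content_le N (ω := ω) hb u v κ
        have h3 : 1 ≤ (Fintype.card V).size := Nat.size_pos.mpr (Fintype.card_pos_iff.mpr ⟨u⟩)
        rw [Nat.add_mul] at *
        omega

end Correctness

/-! ### Probabilities -/

section Probability

variable {V : Type}

instance : IsProbabilityMeasure (coinMeasure V) := by
  unfold coinMeasure
  infer_instance

lemma coinMeasure_forall_eq {ι : Type*} [Fintype ι] {g : ι → V × ℕ × ℕ}
    (hg : Function.Injective g) (y : ι → Bool) :
    (coinMeasure V).real {ω | ∀ j, ω (g j) = y j} = 1 / (2 ^ Fintype.card ι : ℕ) := by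
  classical
  have h1 : {ω : Coins V | ∀ j, ω (g j) = y j} =
      Set.pi (Finset.univ.map ⟨g, hg⟩ : Finset _) fun k =>
        {Function.extend g y (fun _ => false) k} := by
    ext ω
    simp [Set.mem_pi, hg.extend_apply]
  have h2 : ∀ c : Bool, (PMF.uniformOfFintype Bool).toMeasure {c} = 2⁻¹ := by
    intro c
    rw [PMF.toMeasure_apply_singleton _ _ (measurableSet_singleton c)]
    simp
  rw [measureReal_def, h1, coinMeasure,
    Measure.infinitePi_pi _ fun _ _ => measurableSet_singleton _,
    Finset.prod_congr rfl fun _ _ => h2 _, Finset.prod_const, Finset.card_map, Finset.card_univ]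
  simp

end Probability

/-! ### Uniformity of the circulation and the error probability -/

section Correctness

open Classical

variable {V : Type} [Fintype V] (N : Network V) {b : ℕ}

omit [Fintype V] in
lemma Network.exists_ends (e : N.NonTreeEdge) :
    ∃ p : V × V, s(p.1, p.2) = e.1 ∧ N.ID p.1 < N.ID p.2 := by
  obtain ⟨e, he, -⟩ := e
  induction e with
  | h u v =>
    have hne : N.ID u ≠ N.ID v := fun h => SimpleGraph.Adj.ne he (N.ID_injective h)
    rcases hne.lt_or_gt with h | h
    · exact ⟨(u, v), rfl, h⟩
    · exact ⟨(v, u), Sym2.eq_swap, h⟩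

/-- The ends of a non-tree edge, the one with the smaller identifier first. -/
def Network.ends (e : N.NonTreeEdge) : V × V := (N.exists_ends e).choose

omit [Fintype V] in
lemma Network.mk_ends (e : N.NonTreeEdge) : s((N.ends e).1, (N.ends e).2) = e.1 :=
  (N.exists_ends e).choose_spec.1

omit [Fintype V] in
lemma Network.ID_ends (e : N.NonTreeEdge) : N.ID (N.ends e).1 < N.ID (N.ends e).2 :=
  (N.exists_ends e).choose_spec.2

/-- The coin which decides about a bit of the label of a non-tree edge. -/
def Network.labelCoin (p : N.NonTreeEdge × Fin b) : V × ℕ × ℕ :=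
  ((N.ends p.1).1, N.sendTime (true, false) (N.ends p.1).1 - 1, N.ID (N.ends p.1).2 * b + p.2)

/-- Since `i < b`, division of the coin index by `b` recovers the ID of the larger end and the bit;
the vertex flipping the coin is the other end. -/
lemma Network.labelCoin_injective : Function.Injective (N.labelCoin (b := b)) := by
  rintro ⟨e, i⟩ ⟨e', i'⟩ h
  simp only [labelCoin, Prod.mk.injEq] at h
  obtain ⟨h1, -, h2⟩ := h
  have hb : 0 < b := i.pos
  have h3 : N.ID (N.ends e).2 = N.ID (N.ends e').2 := by
    have := congrArg (· / b) h2
    simpa [Nat.mul_comm _ b, Nat.mul_add_div hb, Nat.div_eq_of_lt i.2, Nat.div_eq_of_lt i'.2]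
      using this
  have h4 : i = i' := by
    rw [h3] at h2
    exact Fin.ext (by omega)
  have h5 : e = e' := by
    apply Subtype.ext
    rw [← N.mk_ends e, ← N.mk_ends e', h1, N.ID_injective h3]
  rw [h4, h5]

/-- A circulation is determined off the tree, so obtaining a given one prescribes exactly one coin
for each bit of each non-tree edge. -/
lemma completionLabel_eq_iff (ω : Coins V) {φ : N.graph.edgeSet → Fin b → Bool}
    (hφ : IsBitCirculation N.graph b φ) :
    N.completionLabel (N.chordLabel_comm ω b) = φ ↔
      ∀ p : N.NonTreeEdge × Fin b, ω (N.labelCoin p) = φ ⟨p.1.1, p.1.2.1⟩ p.2 := by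
  have key : ∀ e : N.NonTreeEdge, ∀ u v, s(u, v) = e.1 →
      N.chordLabel ω b u v = fun i => ω (N.labelCoin (e, i)) := by
    intro e u v h
    have h1 : N.chordLabel ω b u v = N.chordLabel ω b (N.ends e).1 (N.ends e).2 := by
      rw [← N.mk_ends e] at h
      rcases Sym2.eq_iff.mp h with ⟨h2, h3⟩ | ⟨h2, h3⟩
      · rw [h2, h3]
      · rw [h2, h3, N.chordLabel_comm]
    rw [h1, Network.chordLabel, if_pos (N.ID_ends e)]
    rfl
  constructor
  · rintro rfl ⟨⟨e, he⟩, i⟩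
    induction e with
    | h u v =>
      change _ = N.completion (N.chordLabel ω b) u v i
      rw [Network.completion, if_neg (fun h => he.2 (Or.inl h)), if_neg (fun h => he.2 (Or.inr h)),
        key ⟨_, he⟩ u v rfl]
  · intro h
    funext ⟨e, he⟩
    induction e with
    | h u v =>
      refine (N.eq_completion_of_isBitCirculation hφ (fun u v huv hn => ?_) u v he).symm
      rw [key ⟨s(u, v), huv, hn⟩ u v rfl]
      exact funext fun i => (h (⟨s(u, v), huv, hn⟩, i)).symm

lemma coinMeasure_completionLabel_eq {φ : N.graph.edgeSet → Fin b → Bool}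
    (hφ : IsBitCirculation N.graph b φ) :
    (coinMeasure V).real {ω | N.completionLabel (N.chordLabel_comm ω b) = φ} =
      1 / (Nat.card {ψ : N.graph.edgeSet → Fin b → Bool // IsBitCirculation N.graph b ψ} : ℝ) := by
  simp only [completionLabel_eq_iff N _ hφ]
  rw [N.card_circulations, coinMeasure_forall_eq N.labelCoin_injective]

variable {O : Type} (f : ℕ × ℕ → ℕ) (r : CutEdgeOutput → O)

lemma samplesCirculation (hf : f (N.subtreeCount N.leader) = b) {tl : O → TreeAndLabels}
    (htl : ∀ x, tl (r x) = x.toTreeAndLabels) :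
    SamplesCirculation N (circulationAlgorithm f r) tl b := by
  intro φ hφ
  rw [← coinMeasure_completionLabel_eq N hφ]
  congr 1
  ext ω
  obtain ⟨out, h1, h2⟩ := exists_outputSpec N ω f r hf
  constructor
  · rintro ⟨out', h3, h4⟩
    rw [haltsWith_unique h3 h2] at h4
    simp only [htl] at h4
    funext ⟨e, he⟩
    induction e with
    | h u v => exact List.ofFn_injective ((h1.describesLabelling u v he).symm.trans (h4 u v he))
  · rintro rfl
    refine ⟨_, h2, ?_⟩
    simp only [htl]
    exact h1.describesLabelling

/-- The event is covered by the outcomes that give one of the circulations vanishing at `e`. These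
are equally likely and make up at most a fraction `2 ^ (-b)` of all. -/
lemma coinMeasure_completionLabel_zero_le {e : Sym2 V} (he : e ∈ N.graph.edgeSet)
    (hcut : ¬ IsCutEdge N.graph e) :
    (coinMeasure V).real {ω | N.completionLabel (N.chordLabel_comm ω b) ⟨e, he⟩ = 0} ≤
      1 / 2 ^ b := by
  let S : Finset (N.graph.edgeSet → Fin b → Bool) :=
    Finset.univ.filter fun ψ => IsBitCirculation N.graph b ψ ∧ ψ ⟨e, he⟩ = 0
  have h1 : {ω | N.completionLabel (N.chordLabel_comm ω b) ⟨e, he⟩ = 0} ⊆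
      ⋃ ψ ∈ S, {ω | N.completionLabel (N.chordLabel_comm ω b) = ψ} := by
    intro ω hω
    simp only [Set.mem_iUnion]
    exact ⟨_, Finset.mem_filter.mpr
      ⟨Finset.mem_univ _, N.isBitCirculation_completionLabel _, hω⟩, rfl⟩
  refine (measureReal_mono h1 (measure_ne_top _ _)).trans
    ((measureReal_biUnion_finset_le _ _).trans ?_)
  rw [Finset.sum_congr rfl fun ψ hψ =>
    coinMeasure_completionLabel_eq N (Finset.mem_filter.mp hψ).2.1, Finset.sum_const, nsmul_eq_mul,
    mul_one_div]
  have h2 := card_circulations_zero_mul_le (b := b) N.connected he hcut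
  have h3 : Nat.card {ψ : N.graph.edgeSet → Fin b → Bool //
      IsBitCirculation N.graph b ψ ∧ ψ ⟨e, he⟩ = 0} = S.card := by
    rw [Nat.card_eq_fintype_card, Fintype.card_subtype]
  rw [h3] at h2
  have h4 : 0 < Nat.card {ψ : N.graph.edgeSet → Fin b → Bool // IsBitCirculation N.graph b ψ} := by
    rw [N.card_circulations]
    positivity
  rw [div_le_div_iff₀ (by exact_mod_cast h4) (by positivity), one_mul]
  exact_mod_cast h2

lemma le_cutEdgeSuccess (hf : f (N.subtreeCount N.leader) = b)
    (hb : Fintype.card V * N.numEdges ≤ 2 ^ b) :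
    1 - 1 / (Fintype.card V : ℝ) ≤ cutEdgeSuccess N (circulationAlgorithm f id) := by
  let bad : N.graph.edgeSet → Set (Coins V) := fun e =>
    {ω | ¬ IsCutEdge N.graph e.1 ∧ N.completionLabel (N.chordLabel_comm ω b) e = 0}
  have h1 : ∀ e, (coinMeasure V).real (bad e) ≤ 1 / 2 ^ b := by
    rintro ⟨e, he⟩
    by_cases hcut : IsCutEdge N.graph e
    · have : bad ⟨e, he⟩ = ∅ := Set.eq_empty_of_forall_notMem fun ω hω => hω.1 hcut
      rw [this, measureReal_empty]
      positivity
    · exact (measureReal_mono fun ω hω => hω.2).trans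
        (coinMeasure_completionLabel_zero_le N he hcut)
  -- Covering the whole space by success and bad events needs only subadditivity, so measurability
  -- of the success event plays no role.
  have h2 : (Set.univ : Set (Coins V)) ⊆ {ω | ∃ out,
      (circulationAlgorithm f id).HaltsWith N ω out ∧ DescribesCutEdges N out} ∪ ⋃ e, bad e := by
    intro ω _
    by_cases h : ∃ e, ω ∈ bad e
    · exact Or.inr (Set.mem_iUnion.mpr h)
    · obtain ⟨out, h3, h4⟩ := exists_outputSpec N ω f id hf
      exact Or.inl ⟨out, h4, h3.describesCutEdges fun e he h0 => h ⟨e, he, h0⟩⟩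
  have h3 : (coinMeasure V).real (⋃ e, bad e) ≤ 1 / (Fintype.card V : ℝ) := by
    refine (measureReal_iUnion_fintype_le _).trans ((Finset.sum_le_sum fun e _ => h1 e).trans ?_)
    have hn : 0 < Fintype.card V := Fintype.card_pos_iff.mpr ⟨N.leader⟩
    have hm : (Finset.univ : Finset N.graph.edgeSet).card = N.numEdges := by
      rw [Finset.card_univ, Network.numEdges, ← Nat.card_coe_set_eq, Nat.card_eq_fintype_card]
    rw [Finset.sum_const, nsmul_eq_mul, mul_one_div, hm,
      div_le_div_iff₀ (by positivity) (by exact_mod_cast hn), one_mul, mul_comm]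
    exact_mod_cast hb
  have h4 := (measureReal_mono h2 (μ := coinMeasure V)).trans (measureReal_union_le _ _)
  rw [probReal_univ] at h4
  rw [cutEdgeSuccess]
  linarith

/-- The number of bits which suffices to tell apart cut edges from other edges. -/
def cutEdgeBits (x : ℕ × ℕ) : ℕ := Nat.clog 2 (x.1 * (x.2 / 2))

/-- The second count is the sum of the degrees, which explains the halving in `cutEdgeBits`. -/
lemma cutEdgeBits_subtreeCount : cutEdgeBits (N.subtreeCount N.leader) =
    Nat.clog 2 (Fintype.card V * N.numEdges) := by
  rw [N.subtreeCount_leader, cutEdgeBits, Nat.mul_div_cancel_left _ two_pos]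

lemma clog_card_mul_numEdges_le :
    Nat.clog 2 (Fintype.card V * N.numEdges) ≤ 3 * (Fintype.card V).size := by
  refine Nat.clog_le_of_le_pow ?_
  have h1 : Fintype.card V < 2 ^ (Fintype.card V).size := Nat.lt_size_self _
  have h2 : N.numEdges ≤ Fintype.card V ^ 2 := by
    have h3 : 2 * N.numEdges ≤ Fintype.card V * Fintype.card V := by
      rw [← N.sum_card_nbrs, ← smul_eq_mul]
      exact Finset.sum_le_card_nsmul _ _ _ fun v _ =>
        Finset.card_image_le.trans (Finset.card_le_univ _)
    rw [sq]
    omega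
  calc Fintype.card V * N.numEdges ≤ Fintype.card V * Fintype.card V ^ 2 :=
        Nat.mul_le_mul_left _ h2
    _ = Fintype.card V ^ 3 := by ring
    _ ≤ (2 ^ (Fintype.card V).size) ^ 3 := Nat.pow_le_pow_left h1.le 3
    _ = 2 ^ (3 * (Fintype.card V).size) := by rw [← pow_mul, mul_comm]

end Correctness
end Congest

end

theorem mainTheorem6 :
    -- sampling random `b`-bit circulations, for `b = O(log |V|)`
    (∃ (A : ℕ → Congest.Algorithm Congest.TreeAndLabels) (Ctime Cmsgs : ℕ),
      ∀ c k : ℕ, ∃ Cbits : ℕ,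
        ∀ (V : Type) [Fintype V] (N : Congest.Network V),
          (∀ v, (N.ID v).size ≤ k * (Fintype.card V).size) →
          ∀ b ≤ c * (Fintype.card V).size,
            (A b).RunsWithin N (Ctime * N.graph.diam) (Cmsgs * N.numEdges)
                (Cbits * (Fintype.card V).size) ∧
              Congest.BuildsBFSTree N (A b) id ∧
              Congest.SamplesCirculation N (A b) id b) ∧
    -- finding all cut edges
    (∃ (A : Congest.Algorithm Congest.CutEdgeOutput) (Ctime Cmsgs : ℕ),
      ∀ k : ℕ, ∃ Cbits : ℕ,
        ∀ (V : Type) [Fintype V] (N : Congest.Network V),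
          (∀ v, (N.ID v).size ≤ k * (Fintype.card V).size) →
            A.RunsWithin N (Ctime * N.graph.diam) (Cmsgs * N.numEdges)
                (Cbits * (Fintype.card V).size) ∧
              Congest.BuildsBFSTree N A Congest.CutEdgeOutput.toTreeAndLabels ∧
              Congest.SamplesCirculation N A Congest.CutEdgeOutput.toTreeAndLabels
                (Nat.clog 2 (Fintype.card V * N.numEdges)) ∧
              1 - 1 / (Fintype.card V : ℝ) ≤ Congest.cutEdgeSuccess N A) := by
  -- One construction serves both parts: `f` is constant when `b` is prescribed, and `cutEdgeBits`
  -- when the leader must compute it from the counts. The `3` in `6 + 3` comes from `|V| |E| ≤ |V| ^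
  -- 3`.
  refine ⟨⟨fun b => Congest.circulationAlgorithm (fun _ => b)
      Congest.CutEdgeOutput.toTreeAndLabels, 10, 8, fun c k => ⟨6 + c, fun V _ N _ b hb =>
        ⟨Congest.runsWithin N _ _ rfl hb, Congest.buildsBFSTree N _ _ rfl fun _ => rfl,
          Congest.samplesCirculation N _ _ rfl fun _ => rfl⟩⟩⟩,
    ⟨Congest.circulationAlgorithm Congest.cutEdgeBits id, 10, 8,
      fun k => ⟨6 + 3, fun V _ N _ => ?_⟩⟩⟩
  have hf := Congest.cutEdgeBits_subtreeCount N
  exact ⟨Congest.runsWithin N _ _ hf (Congest.clog_card_mul_numEdges_le N),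
    Congest.buildsBFSTree N _ _ hf fun _ => rfl, Congest.samplesCirculation N _ _ hf fun _ => rfl,
    Congest.le_cutEdgeSuccess N _ hf (Nat.le_pow_clog one_lt_two _)⟩
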